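/- Let $\mathbb H$ be the real quaternions, $Sp(2)=\{g\in GL(2,\mathbb H) : g^*g=1\}$ with Lie algebra $\mathfrak{sp}(2)=\{X\in\mathfrak{gl}(2,\mathbb H): X+X^*=0\}$, and let $Sph\subset Sp(2)$ be the subgroup $Sp(1)\times Sp(1)$ of diagonal matrices. A smooth $4$-vector field $\xi$ on a manifold $M$ is called a quatrisson structure if its Schouten bracket with itself vanishes, $[\xi,\xi]=0$. Put $$E=\begin{pmatrix}0&1\\-1&0\end{pmatrix},\qquad S_x=\begin{pmatrix}0&x\\x&0\end{pmatrix}\ (x\in\{\mathbf i,\mathbf j,\mathbf k\}),\qquad \Lambda=E\wedge S_{\mathbf i}\wedge S_{\mathbf j}\wedge S_{\mathbf k}\in\wedge^4\mathfrak{sp}(2),$$ and let $\Lambda^L$ and $\Lambda^R$ be the left- and right-invariant $4$-vector fields on $Sp(2)$ with value $\Lambda$ at the identity. (0) The coset space $Sph\backslash Sp(2)$ is identified with the quaternionic projective line $\mathbb{HP}^1$ of (left) lines in $\mathbb H^2$ by sending $Sph\cdot g$ to the line spanned by the first row of $g$. With its manifold structure given by the two affine charts, the projection $p:Sp(2)\to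 Sph\backslash Sp(2)$ is a smooth submersion, and $Sph\backslash Sp(2)$ is diffeomorphic to the sphere $S^4$. (1) $\pi=\Lambda^L-\Lambda^R$ is a quatrisson structure on $Sp(2)$. (2) $\pi$ descends to $\mathbb{HP}^1\simeq Sph\backslash Sp(2)\simeq S^4$: there is a unique $4$-vector field $\aleph$ on $Sph\backslash Sp(2)$ with $p_*(\pi(g))=\aleph(p(g))$ for all $g\in Sp(2)$. Moreover, $\aleph$ is a quatrisson structure on $Sph\backslash Sp(2)$, and it is invariant under the right action $Sph\cdot g\mapsto Sph\cdot gs$ of all $s\in Sph$. (It is called the Bruhat quatrisson structure.) -/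

import Mathlib

open scoped Quaternion Manifold ContDiff Nat

noncomputable section MultivectorFields

variable {E : Type*} [NormedAddCommGroup E] [NormedSpace ℝ E] {H : Type*} [TopologicalSpace H]
  (I : ModelWithCorners ℝ E H) {M : Type*} [TopologicalSpace M] [ChartedSpace H M]
  {E' : Type*} [NormedAddCommGroup E'] [NormedSpace ℝ E'] {H' : Type*} [TopologicalSpace H']
  (J : ModelWithCorners ℝ E' H') {N : Type*} [TopologicalSpace N] [ChartedSpace H' N]

variable (M) in
/-- (Not necessarily smooth) `p`-vector fields on `M`: sections of the bundle `⋀ᵖ TM`. -/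
abbrev MultivectorField (p : ℕ) : Type _ := ∀ x : M, ⋀[ℝ]^p (TangentSpace I x)

variable {I}

/-- The function `P(df₁ ∧ ⋯ ∧ df_p)` obtained by pairing a `p`-vector field `P` with the
differentials of `p` functions. For `P = X₁ ∧ ⋯ ∧ X_p` it is `det (X_i f_j)`. -/
def MultivectorField.eval {p : ℕ} (P : MultivectorField I M p) (f : Fin p → M → ℝ) (x : M) : ℝ :=
  exteriorPower.pairingDual ℝ (TangentSpace I x) p
    (exteriorPower.ιMulti ℝ p fun i =>
      (mvfderiv I (f i) x).toLinearMap) (P x)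

/-- A `p`-vector field is smooth if all the functions `P(df₁ ∧ ⋯ ∧ df_p)` are smooth, for smooth
functions `f₁, …, f_p`. -/
def MultivectorField.IsSmooth {p : ℕ} (P : MultivectorField I M p) : Prop :=
  ∀ f : Fin p → M → ℝ, (∀ i, ContMDiff I 𝓘(ℝ, ℝ) ∞ (f i)) → ContMDiff I 𝓘(ℝ, ℝ) ∞ (P.eval f)

/-- For a `(p+1)`-vector field `P` and a `(q+1)`-vector field `Q`, the sum over all
`(q+1, p)`-shuffles `σ` of the functions
`sign σ • P(d(Q(df_{σ 0} ∧ ⋯ ∧ df_{σ q})) ∧ df_{σ (q+1)} ∧ ⋯ ∧ df_{σ (p+q)})`. The sum is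
written over all permutations, each shuffle being counted `(q+1)! p!` times. -/
def MultivectorField.insertion {p q : ℕ} (P : MultivectorField I M (p + 1))
    (Q : MultivectorField I M (q + 1)) (f : Fin (p + q + 1) → M → ℝ) (x : M) : ℝ :=
  ((((q + 1)! * p ! : ℕ) : ℝ))⁻¹ * ∑ σ : Equiv.Perm (Fin (p + q + 1)),
    ((Equiv.Perm.sign σ : ℤ) : ℝ) *
      P.eval (Fin.cons (Q.eval fun i : Fin (q + 1) => f (σ ⟨i, by omega⟩))
        (fun j : Fin p => f (σ ⟨q + 1 + j, by omega⟩))) x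

/-- `R` is the Schouten bracket `[P, Q]`. On vector fields (`p = q = 0`) this says that
`R f = P (Q f) - Q (P f)`, and in general the signs are those for which
`[P, Q] = (-1)^{ab} [Q, P]` and `[P, Q ∧ R] = [P, Q] ∧ R + (-1)^{ab + b} Q ∧ [P, R]`,
where `a = p + 1` and `b = q + 1` are the degrees of `P` and `Q`. -/
def IsSchoutenBracket {p q : ℕ} (P : MultivectorField I M (p + 1))
    (Q : MultivectorField I M (q + 1)) (R : MultivectorField I M (p + q + 1)) : Prop :=
  ∀ f : Fin (p + q + 1) → M → ℝ, (∀ i, ContMDiff I 𝓘(ℝ, ℝ) ∞ (f i)) → ∀ x,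
    R.eval f x = (-1) ^ (p * (q + 1)) * P.insertion Q f x
      - (-1) ^ p * Q.insertion P (fun i => f (Fin.cast (by omega) i)) x

/-- A quatrisson structure: a smooth `4`-vector field `ξ` with `[ξ, ξ] = 0`. -/
def IsQuatrisson (ξ : MultivectorField I M 4) : Prop :=
  ξ.IsSmooth ∧ IsSchoutenBracket (p := 3) (q := 3) ξ ξ 0

variable (I) in
/-- The `p`-vector `F_* P` at `F x`, for a `p`-vector `P` at `x`. -/
def pushforwardAt {p : ℕ} (F : M → N) (x : M) (P : ⋀[ℝ]^p (TangentSpace I x)) :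
    ⋀[ℝ]^p (TangentSpace J (F x)) :=
  exteriorPower.map p (mfderiv I J F x).toLinearMap P

variable {G : Type*} [Group G] [TopologicalSpace G] [ChartedSpace H G]

/-- The left-invariant multivector field on a Lie group with a given value at the identity. -/
def leftInvariantField {p : ℕ} (v : ⋀[ℝ]^p (GroupLieAlgebra I G)) : MultivectorField I G p :=
  fun g => pushforwardAt I I (fun h : G => g * h) 1 v

/-- The right-invariant multivector field on a Lie group with a given value at the identity. -/
def rightInvariantField {p : ℕ} (v : ⋀[ℝ]^p (GroupLieAlgebra I G)) : MultivectorField I G p :=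
  fun g => pushforwardAt I I (fun h : G => h * g) 1 v

end MultivectorFields

noncomputable section CayleyTransform

variable {A : Type*} [NormedRing A] [NormedAlgebra ℝ A]

/-- The Cayley transform. -/
def cayley (X : A) : A := (1 + (1 / 2 : ℝ) • X) * Ring.inverse (1 - (1 / 2 : ℝ) • X)

/-- The inverse Cayley transform. -/
def invCayley (g : A) : A := (2 : ℝ) • ((g - 1) * Ring.inverse (g + 1))

theorem cayley_add_one {X : A} (hX : IsUnit (1 - (1 / 2 : ℝ) • X)) :
    cayley X + 1 = (2 : ℝ) • Ring.inverse (1 - (1 / 2 : ℝ) • X) := by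
  have h := Ring.mul_inverse_cancel _ hX
  set Y := (1 / 2 : ℝ) • X
  calc cayley X + 1 = (1 + Y) * Ring.inverse (1 - Y) + (1 - Y) * Ring.inverse (1 - Y) := by
        rw [h, cayley]
    _ = _ := by rw [← add_mul, two_smul]; noncomm_ring

theorem isUnit_two_smul {a : A} (ha : IsUnit a) : IsUnit ((2 : ℝ) • a) := by
  obtain ⟨u, rfl⟩ := ha
  exact ⟨(Units.mk0 (2 : ℝ) two_ne_zero) • u, by simp [Units.smul_def]⟩

theorem inverse_two_smul {a : A} (ha : IsUnit a) :
    Ring.inverse ((2 : ℝ) • a) = (1 / 2 : ℝ) • Ring.inverse a := by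
  have h := isUnit_two_smul ha
  apply h.mul_left_cancel
  rw [Ring.mul_inverse_cancel _ h]
  simp [smul_smul, Ring.mul_inverse_cancel _ ha]

theorem isUnit_cayley_add_one {X : A} (hX : IsUnit (1 - (1 / 2 : ℝ) • X)) :
    IsUnit (cayley X + 1) := by
  rw [cayley_add_one hX]
  exact isUnit_two_smul hX.ringInverse

theorem one_sub_invCayley {g : A} (hg : IsUnit (g + 1)) :
    1 - (1 / 2 : ℝ) • invCayley g = (2 : ℝ) • Ring.inverse (g + 1) := by
  have h := Ring.mul_inverse_cancel _ hg
  rw [invCayley, smul_smul, show (1 / 2 : ℝ) * 2 = 1 by norm_num, one_smul]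
  nth_rewrite 1 [← h]
  rw [← sub_mul, two_smul]
  noncomm_ring

theorem one_add_invCayley {g : A} (hg : IsUnit (g + 1)) :
    1 + (1 / 2 : ℝ) • invCayley g = (2 : ℝ) • (g * Ring.inverse (g + 1)) := by
  have h := Ring.mul_inverse_cancel _ hg
  rw [invCayley, smul_smul, show (1 / 2 : ℝ) * 2 = 1 by norm_num, one_smul]
  nth_rewrite 1 [← h]
  rw [← add_mul, two_smul]
  noncomm_ring

theorem isUnit_one_sub_invCayley {g : A} (hg : IsUnit (g + 1)) :
    IsUnit (1 - (1 / 2 : ℝ) • invCayley g) := by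
  rw [one_sub_invCayley hg]
  exact isUnit_two_smul hg.ringInverse

theorem cayley_invCayley {g : A} (hg : IsUnit (g + 1)) : cayley (invCayley g) = g := by
  rw [cayley, one_sub_invCayley hg, one_add_invCayley hg, inverse_two_smul hg.ringInverse,
    Ring.inverse_inverse hg, smul_mul_smul_comm, mul_assoc, Ring.inverse_mul_cancel _ hg]
  norm_num

theorem invCayley_cayley {X : A} (hX : IsUnit (1 - (1 / 2 : ℝ) • X)) :
    invCayley (cayley X) = X := by
  have h := Ring.mul_inverse_cancel _ hX
  have h' : cayley X - 1 = X * Ring.inverse (1 - (1 / 2 : ℝ) • X) := by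
    calc cayley X - 1 = (1 + (1 / 2 : ℝ) • X) * Ring.inverse (1 - (1 / 2 : ℝ) • X)
          - (1 - (1 / 2 : ℝ) • X) * Ring.inverse (1 - (1 / 2 : ℝ) • X) := by rw [h, cayley]
      _ = _ := by
        rw [← sub_mul, add_sub_sub_cancel, ← add_smul]
        norm_num
  rw [invCayley, h', cayley_add_one hX, inverse_two_smul hX.ringInverse, Ring.inverse_inverse hX,
    mul_smul_comm, mul_assoc, Ring.inverse_mul_cancel _ hX, smul_smul]
  norm_num

theorem contDiffAt_cayley [CompleteSpace A] {n : ℕ∞ω} {X : A}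
    (hX : IsUnit (1 - (1 / 2 : ℝ) • X)) : ContDiffAt ℝ n (cayley (A := A)) X := by
  obtain ⟨u, hu⟩ := hX
  have h1 : ContDiffAt ℝ n (Ring.inverse (M₀ := A)) (1 - (1 / 2 : ℝ) • X) :=
    hu ▸ contDiffAt_ringInverse ℝ u
  have h2 : ContDiffAt ℝ n (fun X : A => Ring.inverse (1 - (1 / 2 : ℝ) • X)) X :=
    ContDiffAt.comp (g := Ring.inverse) X h1 (by fun_prop)
  have h3 : ContDiffAt ℝ n (fun X : A => 1 + (1 / 2 : ℝ) • X) X := by fun_prop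
  exact h3.mul h2

theorem hasFDerivAt_cayley_zero [CompleteSpace A] :
    HasFDerivAt (cayley (A := A)) (ContinuousLinearMap.id ℝ A) 0 := by
  have hinv : HasFDerivAt (Ring.inverse (M₀ := A)) (-ContinuousLinearMap.id ℝ A)
      (1 - (1 / 2 : ℝ) • (0 : A)) := by
    have := hasFDerivAt_ringInverse (𝕜 := ℝ) (1 : Aˣ)
    convert! this using 1
    · ext; simp
    · simp
  have hl : HasFDerivAt (fun X : A => 1 - (1 / 2 : ℝ) • X)
      (-((1 / 2 : ℝ) • ContinuousLinearMap.id ℝ A)) 0 :=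
    ((hasFDerivAt_id (0 : A)).const_smul (1 / 2 : ℝ)).const_sub 1
  have hr : HasFDerivAt (fun X : A => 1 + (1 / 2 : ℝ) • X)
      ((1 / 2 : ℝ) • ContinuousLinearMap.id ℝ A) 0 :=
    ((hasFDerivAt_id (0 : A)).const_smul (1 / 2 : ℝ)).const_add 1
  have h := hr.mul' (HasFDerivAt.comp (g := Ring.inverse) (0 : A) hinv hl)
  refine h.congr_fderiv ?_
  ext X
  simp
  rw [← add_smul]; norm_num

theorem contDiffAt_invCayley [CompleteSpace A] {n : ℕ∞ω} {g : A}
    (hg : IsUnit (g + 1)) : ContDiffAt ℝ n (invCayley (A := A)) g := by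
  obtain ⟨u, hu⟩ := hg
  have h1 : ContDiffAt ℝ n (Ring.inverse (M₀ := A)) (g + 1) :=
    hu ▸ contDiffAt_ringInverse ℝ u
  have h2 : ContDiffAt ℝ n (fun g : A => Ring.inverse (g + 1)) g :=
    ContDiffAt.comp (g := Ring.inverse) g h1 (by fun_prop)
  have h3 : ContDiffAt ℝ n (fun g : A => g - 1) g := by fun_prop
  have h4 : ContDiffAt ℝ n (fun g : A => (g - 1) * Ring.inverse (g + 1)) g := h3.mul h2
  exact h4.const_smul (2 : ℝ)

end CayleyTransform

noncomputable section UnitaryManifold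

variable {A : Type*} [NormedRing A] [NormedAlgebra ℝ A] [StarRing A] [StarModule ℝ A]

theorem cayley_mem_unitary {X : A} (hs : star X = -X) (hX : IsUnit (1 - (1 / 2 : ℝ) • X)) :
    cayley X ∈ unitary A := by
  have hs1 : star (1 - (1 / 2 : ℝ) • X) = 1 + (1 / 2 : ℝ) • X := by
    simp [star_smul, hs]
  have hs2 : star (1 + (1 / 2 : ℝ) • X) = 1 - (1 / 2 : ℝ) • X := by
    simp [star_smul, hs, sub_eq_add_neg]
  have hX' : IsUnit (1 + (1 / 2 : ℝ) • X) := hs1 ▸ hX.star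
  have hc : Commute (1 + (1 / 2 : ℝ) • X) (1 - (1 / 2 : ℝ) • X) := by
    generalize (1 / 2 : ℝ) • X = Y
    rw [Commute, SemiconjBy]; noncomm_ring
  have hst : star (cayley X)
      = Ring.inverse (1 + (1 / 2 : ℝ) • X) * (1 - (1 / 2 : ℝ) • X) := by
    rw [cayley, star_mul, ← Ring.inverse_star, hs1, hs2]
  rw [Unitary.mem_iff, hst, cayley]
  generalize (1 + (1 / 2 : ℝ) • X) = v at *
  generalize (1 - (1 / 2 : ℝ) • X) = u at *
  constructor
  · rw [mul_assoc, ← mul_assoc u, ← hc.eq, mul_assoc, Ring.mul_inverse_cancel _ hX, mul_one,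
      Ring.inverse_mul_cancel _ hX']
  · rw [mul_assoc, ← mul_assoc _ _ u, ← hc.ringInverse_ringInverse.eq, mul_assoc,
      Ring.inverse_mul_cancel _ hX, mul_one, Ring.mul_inverse_cancel _ hX']

theorem star_invCayley {g : A} (hg : g ∈ unitary A) (h : IsUnit (g + 1)) :
    star (invCayley g) = -invCayley g := by
  have h1 := (Unitary.mem_iff.1 hg).1
  have hst : star (invCayley g) = (2 : ℝ) • (Ring.inverse (star (g + 1)) * star (g - 1)) := by
    rw [invCayley, star_smul, star_mul, ← Ring.inverse_star, star_trivial]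
  rw [hst, invCayley, ← smul_neg]
  congr 1
  apply h.star.mul_left_cancel
  apply h.mul_right_cancel
  rw [← mul_assoc, Ring.mul_inverse_cancel _ h.star, one_mul, mul_assoc, neg_mul, mul_assoc,
    Ring.inverse_mul_cancel _ h, mul_one]
  simp only [star_sub, star_add, star_one, neg_sub, mul_sub, mul_add, sub_mul, add_mul, mul_one,
    one_mul, h1]
  abel

theorem star_coe_skew (X : skewAdjoint.submodule ℝ A) : star (X : A) = -X :=
  skewAdjoint.mem_iff.1 X.2

variable [ContinuousStar A]

/-- The projection of `A` onto its skew-adjoint part, as a continuous linear map. -/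
def skewPart : A →L[ℝ] skewAdjoint.submodule ℝ A where
  toFun a := ⟨(1 / 2 : ℝ) • (a - star a), by
    simp [skewAdjoint.submodule, skewAdjoint.mem_iff]⟩
  map_add' a b := by
    ext; simp [smul_sub]; abel
  map_smul' c a := by
    ext; simp [smul_sub, star_smul, smul_comm c]
  cont := by fun_prop

theorem skewPart_of_star_eq_neg {a : A} (ha : star a = -a) : (skewPart a : A) = a := by
  simp only [skewPart, ContinuousLinearMap.coe_mk', LinearMap.coe_mk, AddHom.coe_mk, ha]
  rw [sub_neg_eq_add, ← two_smul ℝ a, smul_smul]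
  norm_num

open Classical in
/-- The Cayley transform, with values in the unitary group. -/
def cayleyUnitary (X : skewAdjoint.submodule ℝ A) : unitary A :=
  if h : IsUnit (1 - (1 / 2 : ℝ) • (X : A)) then
    ⟨cayley (X : A), cayley_mem_unitary (star_coe_skew X) h⟩ else 1

theorem coe_cayleyUnitary {X : skewAdjoint.submodule ℝ A}
    (h : IsUnit (1 - (1 / 2 : ℝ) • (X : A))) : (cayleyUnitary X : A) = cayley (X : A) := by
  rw [cayleyUnitary, dif_pos h]

variable [CompleteSpace A]

/-- The chart of the unitary group of `A` centred at `g₀`. It takes values in the Lie algebra of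
skew-adjoint elements, and is inverse to `X ↦ g₀ * cayley X`. -/
def unitaryChart (g₀ : unitary A) :
    OpenPartialHomeomorph (unitary A) (skewAdjoint.submodule ℝ A) where
  toFun g := skewPart (invCayley ((g₀⁻¹ * g : unitary A) : A))
  invFun X := g₀ * cayleyUnitary X
  source := {g | IsUnit (((g₀⁻¹ * g : unitary A) : A) + 1)}
  target := {X | IsUnit (1 - (1 / 2 : ℝ) • (X : A))}
  map_source' g hg := by
    have hg' : IsUnit (((g₀⁻¹ * g : unitary A) : A) + 1) := hg
    simp only [Set.mem_ofPred_eq, skewPart_of_star_eq_neg (star_invCayley (g₀⁻¹ * g).2 hg')]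
    exact isUnit_one_sub_invCayley hg'
  map_target' X hX := by
    simp only [Set.mem_ofPred_eq, inv_mul_cancel_left, coe_cayleyUnitary hX]
    exact isUnit_cayley_add_one hX
  left_inv' g hg := by
    have hg' : IsUnit (((g₀⁻¹ * g : unitary A) : A) + 1) := hg
    have h2 := skewPart_of_star_eq_neg (star_invCayley (g₀⁻¹ * g).2 hg')
    rw [← eq_inv_mul_iff_mul_eq]
    ext
    rw [coe_cayleyUnitary, h2, cayley_invCayley hg']
    rw [h2]
    exact isUnit_one_sub_invCayley hg'
  right_inv' X hX := by
    ext
    rw [inv_mul_cancel_left, coe_cayleyUnitary hX, invCayley_cayley hX,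
      skewPart_of_star_eq_neg (star_coe_skew X)]
  open_source := Units.isOpen.preimage (by fun_prop)
  open_target := Units.isOpen.preimage (by fun_prop)
  continuousOn_toFun := by
    intro g hg
    refine ContinuousAt.continuousWithinAt ?_
    refine skewPart.continuous.continuousAt.comp ?_
    exact ContinuousAt.comp (g := invCayley)
      (f := fun g : unitary A => ((g₀⁻¹ * g : unitary A) : A))
      (contDiffAt_invCayley (n := 0) hg).continuousAt (by fun_prop)
  continuousOn_invFun := by
    refine ContinuousOn.mul continuousOn_const ?_
    rw [Topology.IsInducing.subtypeVal.continuousOn_iff]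
    have : ContinuousOn (fun X : skewAdjoint.submodule ℝ A => cayley (X : A))
        {X | IsUnit (1 - (1 / 2 : ℝ) • (X : A))} := by
      intro X hX
      refine ContinuousAt.continuousWithinAt ?_
      exact ContinuousAt.comp (g := cayley) (f := fun X : skewAdjoint.submodule ℝ A => (X : A))
        (contDiffAt_cayley (n := 0) hX).continuousAt (by fun_prop)
    exact this.congr fun X hX => coe_cayleyUnitary hX

theorem mem_unitaryChart_source (g : unitary A) : g ∈ (unitaryChart g).source := by
  simp only [unitaryChart, Set.mem_ofPred_eq, inv_mul_cancel, OneMemClass.coe_one]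
  have := isUnit_two_smul (isUnit_one (M := A))
  rwa [two_smul] at this

instance unitaryChartedSpace :
    ChartedSpace (skewAdjoint.submodule ℝ A) (unitary A) where
  atlas := Set.range unitaryChart
  chartAt := unitaryChart
  mem_chart_source := mem_unitaryChart_source
  chart_mem_atlas := Set.mem_range_self

theorem unitaryChart_apply (g₀ g : unitary A) :
    unitaryChart g₀ g = skewPart (invCayley (star (g₀ : A) * g)) := rfl

theorem coe_unitaryChart_symm (g₀ : unitary A) {X : skewAdjoint.submodule ℝ A}
    (hX : X ∈ (unitaryChart g₀).target) :
    ((unitaryChart g₀).symm X : A) = g₀ * cayley (X : A) := by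
  rw [← coe_cayleyUnitary hX]; rfl

theorem contDiffAt_coe_unitaryChart_symm {n : ℕ∞ω} (g₀ : unitary A)
    {X : skewAdjoint.submodule ℝ A} (hX : X ∈ (unitaryChart g₀).target) :
    ContDiffAt ℝ n (fun X => ((unitaryChart g₀).symm X : A)) X := by
  have h1 : ContDiffAt ℝ n (fun X : skewAdjoint.submodule ℝ A => cayley (X : A)) X :=
    ContDiffAt.comp (g := cayley) X (contDiffAt_cayley hX)
      (skewAdjoint.submodule ℝ A).subtypeL.contDiff.contDiffAt
  have h2 : ContDiffAt ℝ n (fun X : skewAdjoint.submodule ℝ A => (g₀ : A) * cayley (X : A)) X :=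
    contDiffAt_const.mul h1
  refine h2.congr_of_eventuallyEq ?_
  filter_upwards [(unitaryChart g₀).open_target.mem_nhds hX] with Y hY
  exact coe_unitaryChart_symm g₀ hY

theorem contDiffAt_unitaryChart_ambient {n : ℕ∞ω} (g₀ : unitary A) {g : unitary A}
    (hg : g ∈ (unitaryChart g₀).source) :
    ContDiffAt ℝ n (fun a : A => (skewPart (invCayley (star (g₀ : A) * a)) :
      skewAdjoint.submodule ℝ A)) g := by
  refine ContDiffAt.comp (g := skewPart (A := A)) (g : A)
    (ContinuousLinearMap.contDiff (skewPart (A := A))).contDiffAt ?_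
  exact ContDiffAt.comp (g := invCayley) (g : A) (contDiffAt_invCayley hg)
    (contDiffAt_const.mul contDiffAt_id)

instance unitaryIsManifold (n : ℕ∞ω) :
    IsManifold 𝓘(ℝ, skewAdjoint.submodule ℝ A) n (unitary A) := by
  refine isManifold_of_contDiffOn _ _ _ ?_
  rintro _ _ ⟨g₀, rfl⟩ ⟨g₁, rfl⟩ X ⟨hX, -⟩
  refine ContDiffAt.contDiffWithinAt ?_
  have hX' : X ∈ ((unitaryChart g₀).symm ≫ₕ unitaryChart g₁).source := hX
  rw [OpenPartialHomeomorph.trans_source] at hX'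
  exact ContDiffAt.comp (g := fun a : A => (skewPart (invCayley (star (g₁ : A) * a)) :
      skewAdjoint.submodule ℝ A)) (f := fun X => ((unitaryChart g₀).symm X : A)) X
    (contDiffAt_unitaryChart_ambient g₁ hX'.2) (contDiffAt_coe_unitaryChart_symm g₀ hX'.1)

/-- The inclusion of the unitary group in the algebra is smooth. -/
theorem contMDiff_unitary_coe {n : ℕ∞ω} :
    ContMDiff 𝓘(ℝ, skewAdjoint.submodule ℝ A) 𝓘(ℝ, A) n (fun g : unitary A => (g : A)) := by
  intro g
  rw [contMDiffAt_iff]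
  refine ⟨continuous_subtype_val.continuousAt, ?_⟩
  refine ContDiffAt.contDiffWithinAt ?_
  exact contDiffAt_coe_unitaryChart_symm g ((unitaryChart g).map_source (mem_unitaryChart_source g))

/-- The derivative at the identity of the inclusion of the unitary group in the algebra is the
inclusion of the Lie algebra of skew-adjoint elements. -/
theorem hasMFDerivAt_unitary_coe_one :
    HasMFDerivAt 𝓘(ℝ, skewAdjoint.submodule ℝ A) 𝓘(ℝ, A) (fun g : unitary A => (g : A)) 1
      (skewAdjoint.submodule ℝ A).subtypeL := by
  refine ⟨continuous_subtype_val.continuousAt, ?_⟩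
  have h0 : (unitaryChart (1 : unitary A)) 1 = 0 := by
    rw [unitaryChart_apply]
    simp [invCayley]
  have h1 : extChartAt 𝓘(ℝ, skewAdjoint.submodule ℝ A) (1 : unitary A) 1 = 0 := h0
  rw [h1]
  refine HasFDerivAt.hasFDerivWithinAt ?_
  have h2 : HasFDerivAt (fun X : skewAdjoint.submodule ℝ A => cayley (X : A))
      (skewAdjoint.submodule ℝ A).subtypeL 0 := by
    have h3 := hasFDerivAt_cayley_zero (A := A)
    exact HasFDerivAt.comp (g := cayley) (0 : skewAdjoint.submodule ℝ A) h3
      (skewAdjoint.submodule ℝ A).subtypeL.hasFDerivAt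
  refine h2.congr_of_eventuallyEq ?_
  have h4 : (0 : skewAdjoint.submodule ℝ A) ∈ (unitaryChart (1 : unitary A)).target := by
    rw [← h0]; exact (unitaryChart 1).map_source (mem_unitaryChart_source 1)
  filter_upwards [(unitaryChart 1).open_target.mem_nhds h4] with Y hY
  exact (coe_unitaryChart_symm 1 hY).trans (by simp)

/-- A map to the unitary group is smooth if it is smooth as a map to the algebra. -/
theorem contMDiffAt_unitary_of_coe {n : ℕ∞ω} {E H M : Type*} [NormedAddCommGroup E]
    [NormedSpace ℝ E] [TopologicalSpace H] {I : ModelWithCorners ℝ E H} [TopologicalSpace M]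
    [ChartedSpace H M] {f : M → unitary A} {x : M}
    (hf : ContMDiffAt I 𝓘(ℝ, A) n (fun y => (f y : A)) x) :
    ContMDiffAt I 𝓘(ℝ, skewAdjoint.submodule ℝ A) n f x := by
  rw [contMDiffAt_iff_target]
  refine ⟨Topology.IsInducing.subtypeVal.continuousAt_iff.2 hf.continuousAt, ?_⟩
  exact ContMDiffAt.comp (g := fun a : A => (skewPart (invCayley (star (f x : A) * a)) :
      skewAdjoint.submodule ℝ A)) (f := fun y => (f y : A)) x
    (contDiffAt_unitaryChart_ambient (f x) (mem_unitaryChart_source (f x))).contMDiffAt hf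

instance unitaryLieGroup (n : ℕ∞ω) :
    LieGroup 𝓘(ℝ, skewAdjoint.submodule ℝ A) n (unitary A) where
  contMDiff_mul := fun p => contMDiffAt_unitary_of_coe <| by
    have h1 := (contMDiff_unitary_coe (A := A) (n := n)).comp (contMDiff_fst
      (I := 𝓘(ℝ, skewAdjoint.submodule ℝ A)) (J := 𝓘(ℝ, skewAdjoint.submodule ℝ A))
      (M := unitary A) (N := unitary A)) p
    have h2 := (contMDiff_unitary_coe (A := A) (n := n)).comp (contMDiff_snd
      (I := 𝓘(ℝ, skewAdjoint.submodule ℝ A)) (J := 𝓘(ℝ, skewAdjoint.submodule ℝ A))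
      (M := unitary A) (N := unitary A)) p
    exact ContMDiffAt.comp (g := fun q : A × A => q.1 * q.2) p
      (contDiff_mul.contDiffAt.contMDiffAt) (h1.prodMk_space h2)
  contMDiff_inv := fun g => contMDiffAt_unitary_of_coe <| by
    exact (starL' ℝ : A ≃L[ℝ] A).contDiff.contDiffAt.contMDiffAt.comp g
      (contMDiff_unitary_coe (A := A) (n := n) g)

end UnitaryManifold

noncomputable section QuaternionicLine

/-- The algebra `𝔤𝔩(2, ℍ)` of quaternionic `2 × 2` matrices, with its product topology and the
`ℓ^∞` operator norm, and with conjugate transposition as its star operation. -/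
def QMat : Type := Matrix (Fin 2) (Fin 2) ℍ[ℝ]

instance quaternionStarModule : StarModule ℝ ℍ[ℝ] := ⟨fun r a => by simp⟩

namespace QMat

/-- The matrix with given entries. -/
def of (f : Fin 2 → Fin 2 → ℍ[ℝ]) : QMat := Matrix.of f

/-- The entries of a matrix. -/
def entry (g : QMat) (i j : Fin 2) : ℍ[ℝ] := (show Matrix (Fin 2) (Fin 2) ℍ[ℝ] from g) i j

instance : NormedRing QMat :=
  (Matrix.linftyOpNormedRing : NormedRing (Matrix (Fin 2) (Fin 2) ℍ[ℝ]))

instance : NormedAlgebra ℝ QMat :=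
  letI : SeminormedRing (Matrix (Fin 2) (Fin 2) ℍ[ℝ]) := Matrix.linftyOpSemiNormedRing
  (Matrix.linftyOpNormedAlgebra : NormedAlgebra ℝ (Matrix (Fin 2) (Fin 2) ℍ[ℝ]))

instance : StarRing QMat := inferInstanceAs (StarRing (Matrix (Fin 2) (Fin 2) ℍ[ℝ]))

instance : CompleteSpace QMat := inferInstanceAs (CompleteSpace (Matrix (Fin 2) (Fin 2) ℍ[ℝ]))

instance : ContinuousStar QMat := inferInstanceAs (ContinuousStar (Matrix (Fin 2) (Fin 2) ℍ[ℝ]))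

@[ext] theorem ext {g h : QMat} (H : ∀ i j, g.entry i j = h.entry i j) : g = h := Matrix.ext H

@[simp] theorem entry_of (f : Fin 2 → Fin 2 → ℍ[ℝ]) (i j : Fin 2) :
    (of f).entry i j = f i j := rfl

@[simp] theorem entry_mul (g h : QMat) (i j : Fin 2) :
    (g * h).entry i j = g.entry i 0 * h.entry 0 j + g.entry i 1 * h.entry 1 j :=
  (Matrix.mul_apply (M := g) (N := h)).trans (Fin.sum_univ_two _)

@[simp] theorem entry_star (g : QMat) (i j : Fin 2) : (star g).entry i j = star (g.entry j i) := rfl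

@[simp] theorem entry_neg (g : QMat) (i j : Fin 2) : (-g).entry i j = -g.entry i j := rfl

@[simp] theorem entry_one (i j : Fin 2) : (1 : QMat).entry i j = if i = j then 1 else 0 :=
  Matrix.one_apply

@[simp] theorem entry_smul (r : ℝ) (g : QMat) (i j : Fin 2) :
    (r • g).entry i j = r • g.entry i j := rfl

@[simp] theorem entry_add (g h : QMat) (i j : Fin 2) :
    (g + h).entry i j = g.entry i j + h.entry i j := rfl

instance : StarModule ℝ QMat := ⟨fun r g => by ext1 i j; simp⟩

/-- The entries, as continuous linear maps. -/
def entryL (i j : Fin 2) : QMat →L[ℝ] ℍ[ℝ] where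
  toFun g := g.entry i j
  map_add' _ _ := rfl
  map_smul' _ _ := rfl
  cont := (continuous_id.matrix_elem i j :
    Continuous fun g : Matrix (Fin 2) (Fin 2) ℍ[ℝ] => g i j)

theorem continuous_of {X : Type*} [TopologicalSpace X] {f : X → QMat}
    (h : ∀ i j, Continuous fun x => (f x).entry i j) : Continuous f :=
  (continuous_matrix h : Continuous (Y := Matrix (Fin 2) (Fin 2) ℍ[ℝ]) f)

end QMat

/-- The Lie group `Sp(2) = {g ∈ GL(2, ℍ) | g* g = 1}`. -/
abbrev Sp2 : Type := unitary QMat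

/-- The Lie algebra `𝔰𝔭(2) = {X ∈ 𝔤𝔩(2, ℍ) | X + X* = 0}`. -/
abbrev sp2 : Type := skewAdjoint.submodule ℝ QMat


/-- The spheroid: the subgroup `Sp(1) × Sp(1)` of diagonal matrices in `Sp(2)`. -/
def spheroid : Subgroup Sp2 where
  carrier := {g | QMat.entry g 0 1 = 0 ∧ QMat.entry g 1 0 = 0}
  mul_mem' := by
    rintro g h ⟨h1, h2⟩ ⟨h3, h4⟩
    simp [h1, h2, h3, h4]
  one_mem' := by simp
  inv_mem' := by
    rintro g ⟨h1, h2⟩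
    simp [← Unitary.star_eq_inv, h1, h2]

/-- The quaternionic projective line, as the space `Sph \ Sp(2)` of cosets `Sph · g` with the
quotient topology. -/
abbrev HP1 : Type := Quotient (QuotientGroup.rightRel spheroid)

/-- The projection `Sp(2) → Sph \ Sp(2)`. -/
def projHP1 (g : Sp2) : HP1 := Quotient.mk _ g

theorem proj_eq_iff {g h : Sp2} : projHP1 g = projHP1 h ↔ h * g⁻¹ ∈ spheroid := by
  rw [projHP1, projHP1, Quotient.eq, QuotientGroup.rightRel_apply]

theorem continuous_projHP1 : Continuous projHP1 := continuous_quotient_mk'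

theorem isOpenMap_projHP1 : IsOpenMap projHP1 :=
  isOpenMap_quotient_mk'_mul (Γ := spheroid) (T := Sp2)

theorem projHP1_surjective : Function.Surjective projHP1 := Quotient.mk_surjective

theorem first_row_normSq (g : Sp2) (i : Fin 2) :
    Quaternion.normSq (QMat.entry g 0 i) + Quaternion.normSq (QMat.entry g 0 (i + 1)) = 1 := by
  have h := congrArg (fun m => QMat.entry m 0 0) (Unitary.mem_iff.1 g.2).2
  simp only [QMat.entry_mul, QMat.entry_star, QMat.entry_one, Quaternion.self_mul_star,
    if_true] at h
  have h' : Quaternion.normSq (QMat.entry g 0 0) + Quaternion.normSq (QMat.entry g 0 1) = 1 := by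
    simpa using congrArg QuaternionAlgebra.re h
  fin_cases i
  · simpa using h'
  · simpa [add_comm] using h'

/-- The `i`-th affine coordinate of the line spanned by the first row `(a₀, a₁)` of `g`: it is
`a₀⁻¹ a₁` for `i = 0` and `a₁⁻¹ a₀` for `i = 1`. -/
def affineCoord (i : Fin 2) (g : Sp2) : ℍ[ℝ] :=
  (QMat.entry g 0 i)⁻¹ * QMat.entry g 0 (i + 1)

theorem first_row_of_rel {g h : Sp2} (hr : h * g⁻¹ ∈ spheroid) :
    ∃ u : ℍ[ℝ], u ≠ 0 ∧ ∀ j, QMat.entry h 0 j = u * QMat.entry g 0 j := by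
  refine ⟨QMat.entry (h * g⁻¹ : Sp2) 0 0, ?_, ?_⟩
  · intro h0
    have := first_row_normSq (h * g⁻¹) 0
    rw [h0, zero_add, hr.1] at this
    simp at this
  · intro j
    have h1 : (h : QMat) = ((h * g⁻¹ : Sp2) : QMat) * (g : QMat) := by
      rw [← Submonoid.coe_mul, inv_mul_cancel_right]
    conv_lhs => rw [h1]
    rw [QMat.entry_mul, hr.1, zero_mul, add_zero]

/-- The affine coordinate on the coset space. -/
def affineCoordHP1 (i : Fin 2) : HP1 → ℍ[ℝ] :=
  Quotient.lift (affineCoord i) fun g h hr => by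
    obtain ⟨u, hu, huj⟩ := first_row_of_rel (QuotientGroup.rightRel_apply.1 hr)
    rw [affineCoord, affineCoord, huj, huj, mul_inv_rev, mul_assoc, inv_mul_cancel_left₀ hu]

/-- The locus in `Sph \ Sp(2)` where the `i`-th entry of the first row does not vanish. -/
def affineSource (i : Fin 2) : Set HP1 := projHP1 '' {g | QMat.entry g 0 i ≠ 0}

theorem proj_mem_affineSource {i : Fin 2} {g : Sp2} :
    projHP1 g ∈ affineSource i ↔ QMat.entry g 0 i ≠ 0 := by
  refine ⟨?_, fun h => ⟨g, h, rfl⟩⟩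
  rintro ⟨h, hh, hp⟩
  obtain ⟨u, hu, huj⟩ := first_row_of_rel (proj_eq_iff.1 hp)
  rw [huj]
  exact mul_ne_zero hu hh

/-- A matrix in `Sp(2)` whose first row spans the line with `i`-th affine coordinate `q`. -/
def affineSectionMat (i : Fin 2) (q : ℍ[ℝ]) : QMat :=
  (√(1 + Quaternion.normSq q))⁻¹ •
    QMat.of fun a b => if a = 0 then (if b = i then 1 else q) else (if b = i then -star q else 1)

theorem affineSectionMat_mem (i : Fin 2) (q : ℍ[ℝ]) : affineSectionMat i q ∈ unitary QMat := by
  have hr : (√(1 + Quaternion.normSq q))⁻¹ * (√(1 + Quaternion.normSq q))⁻¹ *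
      (1 + Quaternion.normSq q) = 1 := by
    have h0 : (0 : ℝ) < 1 + Quaternion.normSq q := by
      have := Quaternion.normSq_nonneg (a := q); linarith
    have h1 := Real.mul_self_sqrt h0.le
    have h2 := (Real.sqrt_pos.2 h0).ne'
    field_simp
    nlinarith
  have hr' : ((√(1 + Quaternion.normSq q))⁻¹ * (√(1 + Quaternion.normSq q))⁻¹) •
      ((1 : ℍ[ℝ]) + ((Quaternion.normSq q : ℝ) : ℍ[ℝ])) = 1 := by
    rw [← Quaternion.coe_one, ← Quaternion.coe_add, Quaternion.smul_coe, hr]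
  rw [Unitary.mem_iff, affineSectionMat, star_smul, star_trivial, smul_mul_smul_comm,
    smul_mul_smul_comm]
  generalize (√(1 + Quaternion.normSq q))⁻¹ = r at *
  constructor <;> ext1 a b <;>
    fin_cases i <;> fin_cases a <;> fin_cases b <;>
    simp [Quaternion.self_mul_star, Quaternion.star_mul_self, hr', add_comm _ (1 : ℍ[ℝ])]

/-- A smooth family of matrices in `Sp(2)`, whose first row spans the line with `i`-th affine
coordinate `q`. -/
def affineSection (i : Fin 2) (q : ℍ[ℝ]) : Sp2 := ⟨affineSectionMat i q, affineSectionMat_mem i q⟩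

theorem entry_affineSection (i : Fin 2) (q : ℍ[ℝ]) (a b : Fin 2) :
    QMat.entry (affineSection i q) a b = (√(1 + Quaternion.normSq q))⁻¹ •
      (if a = 0 then (if b = i then 1 else q) else (if b = i then -star q else 1)) := rfl

theorem continuous_affineSection (i : Fin 2) : Continuous (affineSection i) := by
  refine Continuous.subtype_mk (QMat.continuous_of fun a b => ?_) _
  have h0 : ∀ q : ℍ[ℝ], √(1 + Quaternion.normSq q) ≠ 0 := fun q =>
    (Real.sqrt_pos.2 (by have := Quaternion.normSq_nonneg (a := q); linarith)).ne'
  have h1 : Continuous fun q : ℍ[ℝ] => (√(1 + Quaternion.normSq q))⁻¹ :=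
    Continuous.inv₀ (by have := Quaternion.continuous_normSq; fun_prop) h0
  refine h1.smul ?_
  change Continuous fun q : ℍ[ℝ] =>
    (if a = 0 then (if b = i then 1 else q) else (if b = i then -star q else 1))
  split_ifs <;> fun_prop

theorem entry_affineSection_ne_zero (i : Fin 2) (q : ℍ[ℝ]) :
    QMat.entry (affineSection i q) 0 i ≠ 0 := by
  rw [entry_affineSection]
  simp only [if_true]
  refine smul_ne_zero (inv_ne_zero ?_) one_ne_zero
  exact (Real.sqrt_pos.2 (by have := Quaternion.normSq_nonneg (a := q); linarith)).ne'

theorem affineCoord_affineSection (i : Fin 2) (q : ℍ[ℝ]) :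
    affineCoord i (affineSection i q) = q := by
  have h := entry_affineSection_ne_zero i q
  have hi : i + 1 ≠ i := by fin_cases i <;> decide
  have h2 : QMat.entry (affineSection i q) 0 (i + 1) = QMat.entry (affineSection i q) 0 i * q := by
    simp [entry_affineSection, hi]
  rw [affineCoord, h2, inv_mul_cancel_left₀ h]

theorem mem_spheroid_of_entry {k : Sp2} (h : QMat.entry k 0 1 = 0) : k ∈ spheroid := by
  refine ⟨h, ?_⟩
  have h1 := congrArg (fun m => QMat.entry m 1 0) (Unitary.mem_iff.1 k.2).2
  have h2 := first_row_normSq k 0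
  simp only [QMat.entry_mul, QMat.entry_star, QMat.entry_one, h, star_zero, mul_zero,
    add_zero, one_ne_zero, if_false] at h1
  rw [zero_add, h, map_zero, add_zero] at h2
  rcases mul_eq_zero.1 h1 with h1 | h1
  · exact h1
  · rw [star_eq_zero.1 h1] at h2
    simp at h2

theorem proj_affineSection {i : Fin 2} {g : Sp2} (h : QMat.entry g 0 i ≠ 0) :
    projHP1 (affineSection i (affineCoord i g)) = projHP1 g := by
  rw [proj_eq_iff]
  apply mem_spheroid_of_entry
  rw [← Unitary.star_eq_inv, Submonoid.coe_mul, Unitary.coe_star, QMat.entry_mul,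
    QMat.entry_star, QMat.entry_star, entry_affineSection, entry_affineSection]
  generalize (√(1 + Quaternion.normSq (affineCoord i g)))⁻¹ = r
  have h2 : QMat.entry g 0 (i + 1) = QMat.entry g 0 i * affineCoord i g := by
    rw [affineCoord, mul_inv_cancel_left₀ h]
  fin_cases i
  · simp at h2 ⊢
    simp [h2]
  · simp at h2 ⊢
    simp [h2]

theorem continuousAt_affineCoord {i : Fin 2} {g : Sp2} (h : QMat.entry g 0 i ≠ 0) :
    ContinuousAt (affineCoord i) g := by
  have hc : ∀ j, Continuous fun g : Sp2 => QMat.entry g 0 j := fun j =>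
    (QMat.entryL 0 j).continuous.comp continuous_subtype_val
  exact ((hc i).continuousAt.inv₀ h).mul (hc (i + 1)).continuousAt

/-- The `i`-th affine chart of the quaternionic projective line. -/
def affineChart (i : Fin 2) : OpenPartialHomeomorph HP1 ℍ[ℝ] where
  toFun := affineCoordHP1 i
  invFun q := projHP1 (affineSection i q)
  source := affineSource i
  target := Set.univ
  map_source' _ _ := Set.mem_univ _
  map_target' q _ := proj_mem_affineSource.2 (entry_affineSection_ne_zero i q)
  left_inv' := by
    rintro _ ⟨g, hg, rfl⟩
    exact proj_affineSection hg
  right_inv' q _ := affineCoord_affineSection i q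
  open_source := by
    refine isOpenMap_projHP1 _ ?_
    exact isOpen_ne_fun ((QMat.entryL 0 i).continuous.comp continuous_subtype_val)
      continuous_const
  open_target := isOpen_univ
  continuousOn_toFun := by
    rintro _ ⟨g, hg, rfl⟩
    refine ContinuousAt.continuousWithinAt ?_
    have hq : IsOpenQuotientMap projHP1 := ⟨projHP1_surjective, continuous_projHP1, isOpenMap_projHP1⟩
    exact hq.continuousAt_comp_iff.1 (continuousAt_affineCoord hg)
  continuousOn_invFun := (continuous_projHP1.comp (continuous_affineSection i)).continuousOn

theorem exists_mem_affineSource (x : HP1) : ∃ i, x ∈ (affineChart i).source := by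
  obtain ⟨g, rfl⟩ := projHP1_surjective x
  by_contra! h
  have h0 : ∀ i, QMat.entry g 0 i = 0 := fun i => by
    have := h i
    rwa [affineChart, proj_mem_affineSource, not_not] at this
  have := first_row_normSq g 0
  simp [h0] at this

/-- The quaternionic projective line as a manifold, with its two affine charts. -/
instance hp1ChartedSpace : ChartedSpace ℍ[ℝ] HP1 where
  atlas := Set.range affineChart
  chartAt x := affineChart (exists_mem_affineSource x).choose
  mem_chart_source x := (exists_mem_affineSource x).choose_spec
  chart_mem_atlas _ := Set.mem_range_self _

theorem affineCoord_add_one (i : Fin 2) (g : Sp2) :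
    affineCoord (i + 1) g = (affineCoord i g)⁻¹ := by
  have hi : i + 1 + 1 = i := by fin_cases i <;> rfl
  rw [affineCoord, affineCoord, mul_inv_rev, inv_inv, hi]

instance hp1IsManifold (n : ℕ∞ω) : IsManifold 𝓘(ℝ, ℍ[ℝ]) n HP1 := by
  refine isManifold_of_contDiffOn _ _ _ ?_
  rintro _ _ ⟨i, rfl⟩ ⟨j, rfl⟩ q ⟨hq, -⟩
  refine ContDiffAt.contDiffWithinAt ?_
  have hq' : q ∈ ((affineChart i).symm ≫ₕ affineChart j).source := hq
  rw [OpenPartialHomeomorph.trans_source] at hq'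
  have hq2 : QMat.entry (affineSection i q) 0 j ≠ 0 := proj_mem_affineSource.1 hq'.2
  change ContDiffAt ℝ n (fun q => affineCoord j (affineSection i q)) q
  by_cases hij : j = i
  · subst hij
    simp only [affineCoord_affineSection]
    exact contDiffAt_id
  · have hj : j = i + 1 := by fin_cases i <;> fin_cases j <;> simp_all
    subst hj
    simp only [affineCoord_add_one, affineCoord_affineSection]
    have hq0 : q ≠ 0 := by
      rintro rfl
      rw [entry_affineSection] at hq2
      simp [hij] at hq2
    have := contDiffAt_ringInverse (n := n) ℝ (Units.mk0 q hq0)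
    simpa only [Ring.inverse_eq_inv'] using! this

/-- The right translation of `Sph \ Sp(2)` by an element of `Sp(2)`. -/
def rightTranslate (s : Sp2) : HP1 → HP1 :=
  Quotient.map' (fun g => g * s) fun g h hr => by
    rw [QuotientGroup.rightRel_apply] at hr ⊢
    simpa [mul_assoc] using hr

theorem rightTranslate_projHP1 (s g : Sp2) : rightTranslate s (projHP1 g) = projHP1 (g * s) := rfl

end QuaternionicLine

noncomputable section BruhatField

/-- The matrix `E = (0, 1; -1, 0)` in `𝔰𝔭(2)`. -/
def matE : sp2 := ⟨QMat.of ![![0, 1], ![-1, 0]], by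
  rw [skewAdjoint.submodule, Submodule.mem_mk]
  refine skewAdjoint.mem_iff.2 ?_
  ext1 a b; fin_cases a <;> fin_cases b <;> simp⟩

/-- The matrix `S_x = (0, x; x, 0)` in `𝔰𝔭(2)`, for a purely imaginary quaternion `x`. -/
def matS (x : ℍ[ℝ]) (hx : star x = -x) : sp2 := ⟨QMat.of ![![0, x], ![x, 0]], by
  rw [skewAdjoint.submodule, Submodule.mem_mk]
  refine skewAdjoint.mem_iff.2 ?_
  ext1 a b; fin_cases a <;> fin_cases b <;> simp [hx]⟩

/-- The element `Λ = E ∧ S_i ∧ S_j ∧ S_k` of `⋀⁴ 𝔰𝔭(2)`. -/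
def bruhatLambda : ⋀[ℝ]^4 sp2 :=
  exteriorPower.ιMulti ℝ 4 ![matE,
    matS ⟨0, 1, 0, 0⟩ (Quaternion.star_eq_neg.2 rfl),
    matS ⟨0, 0, 1, 0⟩ (Quaternion.star_eq_neg.2 rfl),
    matS ⟨0, 0, 0, 1⟩ (Quaternion.star_eq_neg.2 rfl)]

/-- The identification of `𝔰𝔭(2)` with the tangent space of `Sp(2)` at the identity. The tangent
space is by definition the model space `𝔰𝔭(2)` of the charts, and the identification is the right
one by the next lemma. -/
def sp2ToTangent : sp2 →ₗ[ℝ] GroupLieAlgebra 𝓘(ℝ, sp2) Sp2 := LinearMap.id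

/-- Under the inclusion of `Sp(2)` in the space of matrices, the tangent vector at the identity
defined by a matrix `X` in `𝔰𝔭(2)` is `X`. -/
theorem mfderiv_coe_sp2ToTangent (X : sp2) :
    NormedSpace.fromTangentSpace _ (mfderiv 𝓘(ℝ, sp2) 𝓘(ℝ, QMat) (fun g : Sp2 => (g : QMat)) 1 (sp2ToTangent X)) =
      (X : QMat) :=
  congrArg (fun L : sp2 →L[ℝ] QMat => L X) (hasMFDerivAt_unitary_coe_one (A := QMat)).mfderiv

/-- The `4`-vector field `Λᴸ - Λᴿ` on `Sp(2)`. -/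
def bruhatFieldSp2 : MultivectorField 𝓘(ℝ, sp2) Sp2 4 :=
  leftInvariantField (exteriorPower.map 4 sp2ToTangent bruhatLambda) -
    rightInvariantField (exteriorPower.map 4 sp2ToTangent bruhatLambda)

end BruhatField

/-! Two facts carry the theorem: left- and right-invariant vector fields commute, and Λ is
decomposable and fixed by the adjoint action of the spheroid.

For wedges P of X₀,…,X₃ and Q of Y₀,…,Y₃, expanding the insertion of Q into P gives a signed sum of
7×7 determinants: one row holds the second-order operator X_a Y_b, three rows hold the other Y's and
three the other X's (`insertion_wedgeField`). If X = Y, the six first-order rows draw on four fields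
only, two of them coincide, and the determinant vanishes (`det_bracketRows_self`). If every X
commutes with every Y, exchanging P and Q exchanges two blocks of three rows, which changes the sign
(`det_bracketRows_swap`), so the two mixed insertions cancel. Hence [P - Q, P - Q] = 0
(`isQuatrisson_wedgeField_sub`). For P = Λᴸ and Q = Λᴿ, commutation is the associativity of the
group together with the symmetry of second derivatives (`RepresentedBy.commute`).

For the descent, x ↦ (0, x; -x̄, 0) identifies ℍ with the off-diagonal part of 𝔰𝔭(2) and carries the
wedge of 1, i, j, k to Λ. Conjugation by diag(a, b) becomes x ↦ a x b̄, of determinant |a|⁴|b|⁴ = 1,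
so it fixes Λ (`map_unitaryAd_bruhatLambda`). The image of π(g) in the quotient is the difference of
the pushforwards of Λ along h ↦ p(gh) and h ↦ p(hg). Replacing g by kg with k in the spheroid leaves
the first map alone and precomposes the second with a conjugation (`projectedField_mul`); the same
device gives invariance under right translations (`bruhatFieldHP1_invariant`). The bracket then
vanishes downstairs because it can be computed on functions pulled back by p, and smoothness
descends through local sections of p (`RelatedBy.isQuatrisson`, `exists_local_section`).

The diffeomorphism with S⁴ is induced by the Hopf map; its inverse is given by two stereographic
formulas (`hp1DiffeomorphSphere`). -/

/-! ### Schouten brackets of decomposable 4-vector fields. -/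

noncomputable section DecomposableFields

variable {E : Type*} [NormedAddCommGroup E] [NormedSpace ℝ E] {H : Type*} [TopologicalSpace H]
  {I : ModelWithCorners ℝ E H} {M : Type*} [TopologicalSpace M] [ChartedSpace H M]

/-- The derivative of a function along a vector field. -/
def dirDeriv (X : ∀ x : M, TangentSpace I x) (f : M → ℝ) (x : M) : ℝ := mvfderiv I f x (X x)

/-- A vector field is smooth if it maps smooth functions to smooth functions. -/
def IsSmoothVectorField (X : ∀ x : M, TangentSpace I x) : Prop :=
  ∀ f : M → ℝ, ContMDiff I 𝓘(ℝ, ℝ) ∞ f → ContMDiff I 𝓘(ℝ, ℝ) ∞ (dirDeriv X f)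

/-- The `p`-vector field `X₀ ∧ ⋯ ∧ X_{p-1}`. -/
def wedgeField {p : ℕ} (X : Fin p → ∀ x : M, TangentSpace I x) : MultivectorField I M p :=
  fun x => exteriorPower.ιMulti ℝ p fun i => X i x

theorem eval_wedgeField {p : ℕ} (X : Fin p → ∀ x : M, TangentSpace I x) (f : Fin p → M → ℝ)
    (x : M) : (wedgeField X).eval f x =
      ∑ τ : Equiv.Perm (Fin p), ((Equiv.Perm.sign τ : ℤ) : ℝ) * ∏ i, dirDeriv (X (τ i)) (f i) x := by
  rw [MultivectorField.eval, wedgeField, exteriorPower.pairingDual_ιMulti_ιMulti,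
    Matrix.det_apply']
  rfl

theorem eval_sub {p : ℕ} (P Q : MultivectorField I M p) (f : Fin p → M → ℝ) :
    (P - Q).eval f = fun x => P.eval f x - Q.eval f x := by
  ext x
  exact map_sub _ _ _

theorem dirDeriv_sub (X : ∀ x : M, TangentSpace I x) {f g : M → ℝ} {x : M}
    (hf : MDifferentiableAt I 𝓘(ℝ, ℝ) f x) (hg : MDifferentiableAt I 𝓘(ℝ, ℝ) g x) :
    dirDeriv X (fun y => f y - g y) x = dirDeriv X f x - dirDeriv X g x := by
  rw [dirDeriv, mvfderiv_fun_sub hf hg]; rfl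

theorem dirDeriv_mul (X : ∀ x : M, TangentSpace I x) {f g : M → ℝ} {x : M}
    (hf : MDifferentiableAt I 𝓘(ℝ, ℝ) f x) (hg : MDifferentiableAt I 𝓘(ℝ, ℝ) g x) :
    dirDeriv X (fun y => f y * g y) x = f x * dirDeriv X g x + g x * dirDeriv X f x := by
  rw [dirDeriv, mvfderiv_fun_mul hf hg]; rfl

theorem dirDeriv_const_mul (X : ∀ x : M, TangentSpace I x) (c : ℝ) {f : M → ℝ} {x : M}
    (hf : MDifferentiableAt I 𝓘(ℝ, ℝ) f x) :
    dirDeriv X (fun y => c * f y) x = c * dirDeriv X f x := by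
  have h : dirDeriv X (fun _ => c) x = 0 := by rw [dirDeriv, mvfderiv_const]; rfl
  rw [dirDeriv_mul X mdifferentiableAt_const hf, h, mul_zero, add_zero]

theorem dirDeriv_sum (X : ∀ x : M, TangentSpace I x) {ι : Type*} (s : Finset ι) {f : ι → M → ℝ}
    {x : M} (hf : ∀ i, MDifferentiableAt I 𝓘(ℝ, ℝ) (f i) x) :
    dirDeriv X (fun y => ∑ i ∈ s, f i y) x = ∑ i ∈ s, dirDeriv X (f i) x ∧
      MDifferentiableAt I 𝓘(ℝ, ℝ) (fun y => ∑ i ∈ s, f i y) x := by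
  classical
  induction s using Finset.induction_on with
  | empty =>
    simp only [Finset.sum_empty]
    exact ⟨by rw [dirDeriv, mvfderiv_const]; rfl, mdifferentiableAt_const⟩
  | insert a s ha ih =>
    simp only [Finset.sum_insert ha]
    refine ⟨?_, (hf a).add ih.2⟩
    rw [← ih.1, dirDeriv, mvfderiv_fun_add (hf a) ih.2]; rfl

theorem contMDiff_eval_wedgeField {p : ℕ} {X : Fin p → ∀ x : M, TangentSpace I x}
    (hX : ∀ i, IsSmoothVectorField (X i)) : (wedgeField X).IsSmooth := by
  intro f hf
  have h : (wedgeField X).eval f = fun x => ∑ τ : Equiv.Perm (Fin p),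
      ((Equiv.Perm.sign τ : ℤ) : ℝ) * ∏ i, dirDeriv (X (τ i)) (f i) x :=
    funext fun x => eval_wedgeField X f x
  rw [h]
  refine contMDiff_finsetSum fun τ _ => contMDiff_const.mul ?_
  exact contMDiff_finsetProd fun i _ => hX (τ i) (f i) (hf i)

theorem ContMDiff.mdiffAt_real {f : M → ℝ} (hf : ContMDiff I 𝓘(ℝ, ℝ) ∞ f) (x : M) :
    MDifferentiableAt I 𝓘(ℝ, ℝ) f x := (hf x).mdifferentiableAt (by simp)

/-- The values at `x` of the seven differential operators occurring in the bracket of two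
decomposable `4`-vector fields. -/
def bracketRows (X Y : Fin 4 → ∀ x : M, TangentSpace I x) (τ ρ : Equiv.Perm (Fin 4))
    (f : Fin 7 → M → ℝ) (x : M) : Matrix (Fin 7) (Fin 7) ℝ :=
  Matrix.of ![fun j => dirDeriv (X (τ 0)) (dirDeriv (Y (ρ 0)) (f j)) x,
    fun j => dirDeriv (Y (ρ 1)) (f j) x, fun j => dirDeriv (Y (ρ 2)) (f j) x,
    fun j => dirDeriv (Y (ρ 3)) (f j) x, fun j => dirDeriv (X (τ 1)) (f j) x,
    fun j => dirDeriv (X (τ 2)) (f j) x, fun j => dirDeriv (X (τ 3)) (f j) x]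

theorem dirDeriv_eval_wedgeField (V : ∀ x : M, TangentSpace I x)
    {Y : Fin 4 → ∀ x : M, TangentSpace I x} (hY : ∀ i, IsSmoothVectorField (Y i))
    {f : Fin 4 → M → ℝ} (hf : ∀ i, ContMDiff I 𝓘(ℝ, ℝ) ∞ (f i)) (x : M) :
    dirDeriv V ((wedgeField Y).eval f) x = ∑ ρ : Equiv.Perm (Fin 4),
      ((Equiv.Perm.sign ρ : ℤ) : ℝ) *
       (dirDeriv V (dirDeriv (Y (ρ 0)) (f 0)) x * dirDeriv (Y (ρ 1)) (f 1) x *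
          dirDeriv (Y (ρ 2)) (f 2) x * dirDeriv (Y (ρ 3)) (f 3) x
        + dirDeriv (Y (ρ 0)) (f 0) x * dirDeriv V (dirDeriv (Y (ρ 1)) (f 1)) x *
          dirDeriv (Y (ρ 2)) (f 2) x * dirDeriv (Y (ρ 3)) (f 3) x
        + dirDeriv (Y (ρ 0)) (f 0) x * dirDeriv (Y (ρ 1)) (f 1) x *
          dirDeriv V (dirDeriv (Y (ρ 2)) (f 2)) x * dirDeriv (Y (ρ 3)) (f 3) x
        + dirDeriv (Y (ρ 0)) (f 0) x * dirDeriv (Y (ρ 1)) (f 1) x *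
          dirDeriv (Y (ρ 2)) (f 2) x * dirDeriv V (dirDeriv (Y (ρ 3)) (f 3)) x) := by
  have hd : ∀ i j, MDifferentiableAt I 𝓘(ℝ, ℝ) (dirDeriv (Y i) (f j)) x :=
    fun i j => (hY i _ (hf j)).mdiffAt_real x
  have h : (wedgeField Y).eval f = fun x => ∑ ρ : Equiv.Perm (Fin 4),
      ((Equiv.Perm.sign ρ : ℤ) : ℝ) * (dirDeriv (Y (ρ 0)) (f 0) x * (dirDeriv (Y (ρ 1)) (f 1) x *
        (dirDeriv (Y (ρ 2)) (f 2) x * dirDeriv (Y (ρ 3)) (f 3) x))) := by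
    ext y
    rw [eval_wedgeField]
    simp only [Fin.prod_univ_four, mul_assoc]
  have h3 : ∀ ρ : Equiv.Perm (Fin 4), MDifferentiableAt I 𝓘(ℝ, ℝ)
      (fun y => dirDeriv (Y (ρ 2)) (f 2) y * dirDeriv (Y (ρ 3)) (f 3) y) x :=
    fun ρ => (hd _ _).mul (hd _ _)
  have h2 : ∀ ρ : Equiv.Perm (Fin 4), MDifferentiableAt I 𝓘(ℝ, ℝ)
      (fun y => dirDeriv (Y (ρ 1)) (f 1) y *
        (dirDeriv (Y (ρ 2)) (f 2) y * dirDeriv (Y (ρ 3)) (f 3) y)) x :=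
    fun ρ => (hd _ _).mul (h3 ρ)
  have h1 : ∀ ρ : Equiv.Perm (Fin 4), MDifferentiableAt I 𝓘(ℝ, ℝ)
      (fun y => dirDeriv (Y (ρ 0)) (f 0) y * (dirDeriv (Y (ρ 1)) (f 1) y *
        (dirDeriv (Y (ρ 2)) (f 2) y * dirDeriv (Y (ρ 3)) (f 3) y))) x :=
    fun ρ => (hd _ _).mul (h2 ρ)
  have h0 : ∀ ρ : Equiv.Perm (Fin 4), MDifferentiableAt I 𝓘(ℝ, ℝ)
      (fun y => ((Equiv.Perm.sign ρ : ℤ) : ℝ) *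
        (dirDeriv (Y (ρ 0)) (f 0) y * (dirDeriv (Y (ρ 1)) (f 1) y *
        (dirDeriv (Y (ρ 2)) (f 2) y * dirDeriv (Y (ρ 3)) (f 3) y)))) x :=
    fun ρ => mdifferentiableAt_const.mul (h1 ρ)
  rw [h, (dirDeriv_sum V _ h0).1]
  refine Finset.sum_congr rfl fun ρ _ => ?_
  rw [dirDeriv_const_mul V _ (h1 ρ), dirDeriv_mul V (hd _ _) (h2 ρ), dirDeriv_mul V (hd _ _) (h3 ρ),
    dirDeriv_mul V (hd _ _) (hd _ _)]
  ring

/-- Reindexing by the transposition (0 k) changes the sign of ρ, which compensates the sign in the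
hypothesis. -/
theorem sum_sign_mul_swap {n : ℕ} (k : Fin (n + 1)) (hk : k ≠ 0)
    (F G : Equiv.Perm (Fin (n + 1)) → ℝ) (h : ∀ ρ, F (ρ * Equiv.swap 0 k) = -G ρ) :
    ∑ ρ, ((Equiv.Perm.sign ρ : ℤ) : ℝ) * F ρ = ∑ ρ, ((Equiv.Perm.sign ρ : ℤ) : ℝ) * G ρ := by
  rw [← Equiv.sum_comp (Equiv.mulRight (Equiv.swap 0 k))]
  refine Finset.sum_congr rfl fun ρ _ => ?_
  rw [Equiv.coe_mulRight, h, Equiv.Perm.sign_mul, Equiv.Perm.sign_swap hk.symm]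
  simp

theorem sum_sign_prod_seven (R : Fin 7 → Fin 7 → ℝ) :
    ∑ σ : Equiv.Perm (Fin 7), ((Equiv.Perm.sign σ : ℤ) : ℝ) *
      (R 0 (σ 0) * R 1 (σ 1) * R 2 (σ 2) * R 3 (σ 3) * R 4 (σ 4) * R 5 (σ 5) * R 6 (σ 6)) =
      (Matrix.of R).det := by
  rw [← Matrix.det_transpose, Matrix.det_apply']
  refine Finset.sum_congr rfl fun σ _ => ?_
  rw [Fin.prod_univ_seven]; rfl

/-- The Leibniz rule yields four terms, according to which Y-factor is differentiated, and all
contribute equally: moving the differentiated row to the top costs one row exchange, and relabelling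
ρ by the same transposition costs a second sign. -/
theorem sum_sign_bracketRows (X Y : Fin 4 → ∀ x : M, TangentSpace I x)
    (τ : Equiv.Perm (Fin 4)) (f : Fin 7 → M → ℝ) (x : M) :
    ∑ ρ : Equiv.Perm (Fin 4), ((Equiv.Perm.sign ρ : ℤ) : ℝ) * ∑ σ : Equiv.Perm (Fin 7),
      ((Equiv.Perm.sign σ : ℤ) : ℝ) *
      ((dirDeriv (X (τ 0)) (dirDeriv (Y (ρ 0)) (f (σ 0))) x * dirDeriv (Y (ρ 1)) (f (σ 1)) x *
          dirDeriv (Y (ρ 2)) (f (σ 2)) x * dirDeriv (Y (ρ 3)) (f (σ 3)) x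
        + dirDeriv (Y (ρ 0)) (f (σ 0)) x * dirDeriv (X (τ 0)) (dirDeriv (Y (ρ 1)) (f (σ 1))) x *
          dirDeriv (Y (ρ 2)) (f (σ 2)) x * dirDeriv (Y (ρ 3)) (f (σ 3)) x
        + dirDeriv (Y (ρ 0)) (f (σ 0)) x * dirDeriv (Y (ρ 1)) (f (σ 1)) x *
          dirDeriv (X (τ 0)) (dirDeriv (Y (ρ 2)) (f (σ 2))) x * dirDeriv (Y (ρ 3)) (f (σ 3)) x
        + dirDeriv (Y (ρ 0)) (f (σ 0)) x * dirDeriv (Y (ρ 1)) (f (σ 1)) x *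
          dirDeriv (Y (ρ 2)) (f (σ 2)) x * dirDeriv (X (τ 0)) (dirDeriv (Y (ρ 3)) (f (σ 3))) x) *
        (dirDeriv (X (τ 1)) (f (σ 4)) x * dirDeriv (X (τ 2)) (f (σ 5)) x *
          dirDeriv (X (τ 3)) (f (σ 6)) x)) =
    4 * ∑ ρ : Equiv.Perm (Fin 4), ((Equiv.Perm.sign ρ : ℤ) : ℝ) *
      (bracketRows X Y τ ρ f x).det := by
  set A : Fin 4 → Fin 7 → ℝ := fun i j => dirDeriv (Y i) (f j) x with hA
  set B : Fin 4 → Fin 7 → ℝ := fun i j => dirDeriv (X (τ 0)) (dirDeriv (Y i) (f j)) x with hB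
  set C : Fin 4 → Fin 7 → ℝ := fun i j => dirDeriv (X i) (f j) x with hC
  -- `R k ρ` is the matrix of the term in which the derivative falls on the factor with index k.
  set R : Fin 4 → Equiv.Perm (Fin 4) → Matrix (Fin 7) (Fin 7) ℝ := fun k ρ =>
    Matrix.of ![if k = 0 then B (ρ 0) else A (ρ 0), if k = 1 then B (ρ 1) else A (ρ 1),
      if k = 2 then B (ρ 2) else A (ρ 2), if k = 3 then B (ρ 3) else A (ρ 3),
      C (τ 1), C (τ 2), C (τ 3)] with hR
  have hR0 : ∀ ρ, bracketRows X Y τ ρ f x = R 0 ρ := fun ρ => rfl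
  have h1 : ∀ k : Fin 4, ∑ ρ : Equiv.Perm (Fin 4), ((Equiv.Perm.sign ρ : ℤ) : ℝ) * (R k ρ).det =
      ∑ ρ : Equiv.Perm (Fin 4), ((Equiv.Perm.sign ρ : ℤ) : ℝ) * (R 0 ρ).det := by
    intro k
    by_cases hk : k = 0
    · rw [hk]
    refine sum_sign_mul_swap k hk _ _ fun ρ => ?_
    have h : R k (ρ * Equiv.swap 0 k) =
        (R 0 ρ).submatrix (Equiv.swap (0 : Fin 7) (k.castLE (by omega))) id := by
      ext i j
      fin_cases k
      · exact absurd rfl hk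
      all_goals fin_cases i <;> rfl
    rw [h, Matrix.det_permute, Equiv.Perm.sign_swap]
    · simp
    · intro h0
      have h3 : (k : ℕ) = 0 := congrArg (fun i : Fin 7 => (i : ℕ)) h0.symm
      exact hk (Fin.ext h3)
  have h2 : ∑ ρ : Equiv.Perm (Fin 4), ((Equiv.Perm.sign ρ : ℤ) : ℝ) * (R 0 ρ).det +
      ∑ ρ : Equiv.Perm (Fin 4), ((Equiv.Perm.sign ρ : ℤ) : ℝ) * (R 1 ρ).det +
      ∑ ρ : Equiv.Perm (Fin 4), ((Equiv.Perm.sign ρ : ℤ) : ℝ) * (R 2 ρ).det +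
      ∑ ρ : Equiv.Perm (Fin 4), ((Equiv.Perm.sign ρ : ℤ) : ℝ) * (R 3 ρ).det =
      4 * ∑ ρ : Equiv.Perm (Fin 4), ((Equiv.Perm.sign ρ : ℤ) : ℝ) *
        (bracketRows X Y τ ρ f x).det := by
    simp only [h1, hR0]; ring
  rw [← h2, ← Finset.sum_add_distrib, ← Finset.sum_add_distrib, ← Finset.sum_add_distrib]
  refine Finset.sum_congr rfl fun ρ _ => ?_
  rw [← mul_add, ← mul_add, ← mul_add]
  congr 1
  simp only [hR, ← sum_sign_prod_seven, ← Finset.sum_add_distrib]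
  refine Finset.sum_congr rfl fun σ _ => ?_
  rw [← mul_add, ← mul_add, ← mul_add]
  congr 1
  simp only [Matrix.cons_val, Fin.isValue, if_true, Fin.reduceEq, if_false, hA, hB, hC]
  ring

/-- The 4 counts the equal Leibniz terms, so the total normalisation is 1/(3! 3!): the orderings of
the two blocks of three first-order rows. -/
theorem insertion_wedgeField (X : Fin 4 → ∀ x : M, TangentSpace I x)
    {Y : Fin 4 → ∀ x : M, TangentSpace I x} (hY : ∀ i, IsSmoothVectorField (Y i))
    {f : Fin 7 → M → ℝ} (hf : ∀ i, ContMDiff I 𝓘(ℝ, ℝ) ∞ (f i)) (x : M) :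
    MultivectorField.insertion (p := 3) (q := 3) (wedgeField X) (wedgeField Y) f x =
      (((4 ! * 3 ! : ℕ) : ℝ))⁻¹ * (4 * ∑ τ : Equiv.Perm (Fin 4), ∑ ρ : Equiv.Perm (Fin 4),
        ((Equiv.Perm.sign τ : ℤ) : ℝ) * ((Equiv.Perm.sign ρ : ℤ) : ℝ) *
          (bracketRows X Y τ ρ f x).det) := by
  rw [MultivectorField.insertion]
  congr 1
  have h : ∀ τ : Equiv.Perm (Fin 4), ∑ ρ : Equiv.Perm (Fin 4),
      ((Equiv.Perm.sign τ : ℤ) : ℝ) * ((Equiv.Perm.sign ρ : ℤ) : ℝ) *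
          (bracketRows X Y τ ρ f x).det = ((Equiv.Perm.sign τ : ℤ) : ℝ) *
        ∑ ρ : Equiv.Perm (Fin 4), ((Equiv.Perm.sign ρ : ℤ) : ℝ) *
          (bracketRows X Y τ ρ f x).det := by
    intro τ
    rw [Finset.mul_sum]
    simp only [mul_assoc]
  simp only [h]
  rw [Finset.mul_sum]
  have h' : ∀ τ : Equiv.Perm (Fin 4), 4 * (((Equiv.Perm.sign τ : ℤ) : ℝ) *
        ∑ ρ : Equiv.Perm (Fin 4), ((Equiv.Perm.sign ρ : ℤ) : ℝ) *
          (bracketRows X Y τ ρ f x).det) = ((Equiv.Perm.sign τ : ℤ) : ℝ) * (4 *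
        ∑ ρ : Equiv.Perm (Fin 4), ((Equiv.Perm.sign ρ : ℤ) : ℝ) *
          (bracketRows X Y τ ρ f x).det) := fun τ => by ring
  simp only [h', ← sum_sign_bracketRows]
  simp only [eval_wedgeField, Finset.mul_sum]
  rw [Finset.sum_comm]
  refine Finset.sum_congr rfl fun τ _ => ?_
  rw [Finset.sum_comm]
  refine Finset.sum_congr rfl fun σ _ => ?_
  rw [Fin.prod_univ_four]
  have h0 := dirDeriv_eval_wedgeField (X (τ 0)) hY
    (f := fun i : Fin 4 => f (σ (i.castLE (by omega)))) (fun i => hf _) x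
  have h0' : dirDeriv (X (τ 0)) ((Fin.cons
      (MultivectorField.eval (wedgeField Y) fun i : Fin 4 => f (σ ⟨i, by omega⟩))
        (fun j : Fin 3 => f (σ ⟨3 + 1 + j, by omega⟩)) : Fin 4 → M → ℝ) 0) x = _ := h0
  -- Q consumes the functions with indices σ 0, …, σ 3, so the other slots start at σ 4.
  have e1 : (Fin.cons (MultivectorField.eval (wedgeField Y) fun i : Fin 4 => f (σ ⟨i, by omega⟩))
        (fun j : Fin 3 => f (σ ⟨3 + 1 + j, by omega⟩)) : Fin 4 → M → ℝ) 1 = f (σ 4) := rfl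
  have e2 : (Fin.cons (MultivectorField.eval (wedgeField Y) fun i : Fin 4 => f (σ ⟨i, by omega⟩))
        (fun j : Fin 3 => f (σ ⟨3 + 1 + j, by omega⟩)) : Fin 4 → M → ℝ) 2 = f (σ 5) := rfl
  have e3 : (Fin.cons (MultivectorField.eval (wedgeField Y) fun i : Fin 4 => f (σ ⟨i, by omega⟩))
        (fun j : Fin 3 => f (σ ⟨3 + 1 + j, by omega⟩)) : Fin 4 → M → ℝ) 3 = f (σ 6) := rfl
  rw [h0', e1, e2, e3, Finset.sum_mul, Finset.sum_mul, Finset.sum_mul, Finset.mul_sum,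
    Finset.mul_sum]
  refine Finset.sum_congr rfl fun ρ _ => ?_
  simp only [Fin.castLE, Fin.isValue]
  change _ = ((Equiv.Perm.sign τ : ℤ) : ℝ) * (((Equiv.Perm.sign ρ : ℤ) : ℝ) *
    (((Equiv.Perm.sign σ : ℤ) : ℝ) * (_ * _)))
  ring!

/-- At most one of `ρ a` and `ρ b` can be `τ 0`. -/
theorem exists_perm_eq {τ ρ : Equiv.Perm (Fin 4)} {a b : Fin 4} (hab : a ≠ b) :
    ∃ j, j ≠ 0 ∧ (ρ a = τ j ∨ ρ b = τ j) := by
  by_cases h : ρ a = τ 0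
  · refine ⟨τ⁻¹ (ρ b), fun h0 => hab ?_, Or.inr (by simp)⟩
    rw [Equiv.Perm.inv_eq_iff_eq] at h0
    exact ρ.injective (h.trans h0.symm)
  · refine ⟨τ⁻¹ (ρ a), fun h0 => h ?_, Or.inl (by simp)⟩
    rw [Equiv.Perm.inv_eq_iff_eq] at h0
    exact h0

/-- Two of the rows are equal, since only four vector fields are available. -/
theorem det_bracketRows_self (X : Fin 4 → ∀ x : M, TangentSpace I x) (τ ρ : Equiv.Perm (Fin 4))
    (f : Fin 7 → M → ℝ) (x : M) : (bracketRows X X τ ρ f x).det = 0 := by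
  obtain ⟨j, hj, h⟩ := exists_perm_eq (τ := τ) (ρ := ρ) (a := 1) (b := 2) (by decide)
  rcases h with h | h
  -- For j ≠ 0 the field `X (τ j)` sits in row 3 + j.
  · refine Matrix.det_zero_of_row_eq (i := 1) (j := Fin.natAdd 3 j) ?_ ?_
    · intro h0
      have := congrArg Fin.val h0
      simp at this
      omega
    · fin_cases j
      · exact absurd rfl hj
      all_goals
        ext i
        simp [bracketRows, h]
  · refine Matrix.det_zero_of_row_eq (i := 2) (j := Fin.natAdd 3 j) ?_ ?_
    · intro h0
      have := congrArg Fin.val h0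
      simp at this
      omega
    · fin_cases j
      · exact absurd rfl hj
      all_goals
        ext i
        simp [bracketRows, h]

/-- The two vector fields commute as operators on smooth functions. -/
def CommuteVectorField (X Y : ∀ x : M, TangentSpace I x) : Prop :=
  ∀ f : M → ℝ, ContMDiff I 𝓘(ℝ, ℝ) ∞ f → ∀ x,
    dirDeriv X (dirDeriv Y f) x = dirDeriv Y (dirDeriv X f) x

/-- Commutation identifies the top rows; the two blocks of three first-order rows are exchanged by
three transpositions, an odd permutation. -/
theorem det_bracketRows_swap {X Y : Fin 4 → ∀ x : M, TangentSpace I x}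
    (hc : ∀ i j, CommuteVectorField (X i) (Y j)) (τ ρ : Equiv.Perm (Fin 4))
    {f : Fin 7 → M → ℝ} (hf : ∀ i, ContMDiff I 𝓘(ℝ, ℝ) ∞ (f i)) (x : M) :
    (bracketRows Y X ρ τ f x).det = -(bracketRows X Y τ ρ f x).det := by
  have h : bracketRows Y X ρ τ f x = (bracketRows X Y τ ρ f x).submatrix
      (Equiv.swap (1 : Fin 7) 4 * Equiv.swap 2 5 * Equiv.swap 3 6 : Equiv.Perm (Fin 7)) id := by
    ext i j
    fin_cases i
    · exact (hc _ _ _ (hf j) x).symm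
    all_goals rfl
  rw [h, Matrix.det_permute]
  have hs : Equiv.Perm.sign
      (Equiv.swap (1 : Fin 7) 4 * Equiv.swap 2 5 * Equiv.swap 3 6 : Equiv.Perm (Fin 7)) = -1 := by
    decide
  rw [hs]; simp

/-- The insertion differentiates the functions `R.eval` and `S.eval`, so additivity in the second
argument needs these functions to be differentiable. -/
theorem insertion_sub {P Q R S : MultivectorField I M 4} (hR : R.IsSmooth) (hS : S.IsSmooth)
    {X Y : Fin 4 → ∀ x : M, TangentSpace I x} (hP : P = wedgeField X) (hQ : Q = wedgeField Y)
    {f : Fin 7 → M → ℝ} (hf : ∀ i, ContMDiff I 𝓘(ℝ, ℝ) ∞ (f i)) (x : M) :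
    MultivectorField.insertion (p := 3) (q := 3) (P - Q) (R - S) f x =
      MultivectorField.insertion (p := 3) (q := 3) P R f x -
      MultivectorField.insertion (p := 3) (q := 3) P S f x -
      (MultivectorField.insertion (p := 3) (q := 3) Q R f x -
      MultivectorField.insertion (p := 3) (q := 3) Q S f x) := by
  have key : ∀ (Z : Fin 4 → ∀ x : M, TangentSpace I x) (u v : M → ℝ) (w : Fin 3 → M → ℝ),
      ContMDiff I 𝓘(ℝ, ℝ) ∞ u → ContMDiff I 𝓘(ℝ, ℝ) ∞ v →
      (wedgeField Z).eval (Fin.cons (fun y => u y - v y) w : Fin 4 → M → ℝ) x =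
      (wedgeField Z).eval (Fin.cons u w : Fin 4 → M → ℝ) x -
      (wedgeField Z).eval (Fin.cons v w : Fin 4 → M → ℝ) x := by
    intro Z u v w hu hv
    simp only [eval_wedgeField, ← Finset.sum_sub_distrib]
    refine Finset.sum_congr rfl fun τ _ => ?_
    simp only [Fin.prod_univ_succ, Fin.cons_zero, Fin.cons_succ]
    rw [dirDeriv_sub _ (hu.mdiffAt_real x) (hv.mdiffAt_real x)]
    ring
  simp only [MultivectorField.insertion, ← mul_sub, ← Finset.sum_sub_distrib]
  congr 1
  refine Finset.sum_congr rfl fun σ _ => ?_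
  congr 1
  subst hP hQ
  rw [eval_sub R S, eval_sub]
  simp only
  rw [key X _ _ _ (hR _ fun i => hf _) (hS _ fun i => hf _),
    key Y _ _ _ (hR _ fun i => hf _) (hS _ fun i => hf _)]

/-- The difference of two decomposable `4`-vector fields whose factors commute with one another is
a quatrisson structure. -/
theorem isQuatrisson_wedgeField_sub {X Y : Fin 4 → ∀ x : M, TangentSpace I x}
    (hX : ∀ i, IsSmoothVectorField (X i)) (hY : ∀ i, IsSmoothVectorField (Y i))
    (hc : ∀ i j, CommuteVectorField (X i) (Y j)) :
    IsQuatrisson (wedgeField X - wedgeField Y) := by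
  refine ⟨fun f hf => ?_, fun f hf x => ?_⟩
  · rw [eval_sub]
    exact (contMDiff_eval_wedgeField hX f hf).sub (contMDiff_eval_wedgeField hY f hf)
  · have h0 : MultivectorField.eval (0 : MultivectorField I M (3 + 3 + 1)) f x = 0 := map_zero _
    have h1 : MultivectorField.insertion (p := 3) (q := 3) (wedgeField X - wedgeField Y)
        (wedgeField X - wedgeField Y) f x = 0 := by
      rw [insertion_sub (contMDiff_eval_wedgeField hX) (contMDiff_eval_wedgeField hY) rfl rfl hf,
        insertion_wedgeField X hX hf, insertion_wedgeField Y hY hf, insertion_wedgeField X hY hf,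
        insertion_wedgeField Y hX hf]
      simp only [det_bracketRows_self, mul_zero, Finset.sum_const_zero, zero_sub, sub_zero,
        neg_sub_left, neg_eq_zero, ← mul_add]
      -- Interchanging the sums pairs the index (τ, ρ) of one mixed insertion with (ρ, τ) of the
      -- other; paired determinants are opposite.
      rw [Finset.sum_comm, ← Finset.sum_add_distrib]
      simp only [← Finset.sum_add_distrib, det_bracketRows_swap hc _ _ hf]
      simp [mul_comm]
    rw [h0]
    -- For p = q the cast of indices is the identity, so both terms of the bracket are multiples of
    -- the same insertion.
    change 0 = _ * MultivectorField.insertion (p := 3) (q := 3) (wedgeField X - wedgeField Y)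
        (wedgeField X - wedgeField Y) f x - _ * MultivectorField.insertion (p := 3) (q := 3)
        (wedgeField X - wedgeField Y) (wedgeField X - wedgeField Y) f x
    rw [h1]
    simp

end DecomposableFields

/-! ### Smoothness and commutation of vector fields given by families of curves. -/

noncomputable section VectorFieldsFromCurves

/-- Both sides are values of the second Fréchet derivative at the origin, which is symmetric. The
inner derivatives have to be identified on a neighbourhood of 0, hence the eventual
differentiability. -/
theorem deriv_deriv_comm {ψ : ℝ × ℝ → ℝ} (hψ : ContDiffAt ℝ ∞ ψ (0, 0)) :
    deriv (fun s => deriv (fun t => ψ (s, t)) 0) 0 =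
      deriv (fun t => deriv (fun s => ψ (s, t)) 0) 0 := by
  have hd : ∀ᶠ p in nhds ((0 : ℝ), (0 : ℝ)), DifferentiableAt ℝ ψ p := by
    have := (hψ.of_le (m := 1) (by norm_cast)).eventually (by simp)
    exact this.mono fun p hp => hp.differentiableAt (by simp)
  have h2 : DifferentiableAt ℝ (fderiv ℝ ψ) (0, 0) :=
    (hψ.fderiv_right (m := 1) (by norm_cast)).differentiableAt (by simp)
  have hs : IsSymmSndFDerivAt ℝ ψ (0, 0) :=
    hψ.isSymmSndFDerivAt (by simp only [minSmoothness_of_isRCLikeNormedField]; norm_cast)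
  have hl : ∀ a : ℝ, HasDerivAt (fun s : ℝ => (s, a)) ((1 : ℝ), (0 : ℝ)) 0 := fun a =>
    (hasDerivAt_id 0).prodMk (hasDerivAt_const 0 a)
  have hr : ∀ a : ℝ, HasDerivAt (fun t : ℝ => (a, t)) ((0 : ℝ), (1 : ℝ)) 0 := fun a =>
    (hasDerivAt_const 0 a).prodMk (hasDerivAt_id 0)
  have e1 : (fun s => deriv (fun t => ψ (s, t)) 0) =ᶠ[nhds 0] fun s => fderiv ℝ ψ (s, 0) (0, 1) := by
    have : Filter.Tendsto (fun s : ℝ => (s, (0 : ℝ))) (nhds 0) (nhds (0, 0)) :=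
      (hl 0).continuousAt
    filter_upwards [this.eventually hd] with s h
    exact (h.hasFDerivAt.comp_hasDerivAt (0 : ℝ) (hr s)).deriv
  have e2 : (fun t => deriv (fun s => ψ (s, t)) 0) =ᶠ[nhds 0] fun t => fderiv ℝ ψ (0, t) (1, 0) := by
    have : Filter.Tendsto (fun t : ℝ => ((0 : ℝ), t)) (nhds 0) (nhds (0, 0)) :=
      (hr 0).continuousAt
    filter_upwards [this.eventually hd] with s h
    exact (h.hasFDerivAt.comp_hasDerivAt (0 : ℝ) (hl s)).deriv
  rw [e1.deriv_eq, e2.deriv_eq]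
  have h3 := (HasFDerivAt.comp_hasDerivAt (f := fun s : ℝ => (s, (0 : ℝ))) (0 : ℝ)
    h2.hasFDerivAt (hl 0)).clm_apply
    (hasDerivAt_const (0 : ℝ) ((0 : ℝ), (1 : ℝ)))
  have h4 := (HasFDerivAt.comp_hasDerivAt (f := fun s : ℝ => ((0 : ℝ), s)) (0 : ℝ)
    h2.hasFDerivAt (hr 0)).clm_apply
    (hasDerivAt_const (0 : ℝ) ((1 : ℝ), (0 : ℝ)))
  have h3' := h3.deriv
  have h4' := h4.deriv
  simp only [map_zero, add_zero] at h3' h4'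
  exact h3'.trans ((hs.eq (1, 0) (0, 1)).trans h4'.symm)

variable {E : Type*} [NormedAddCommGroup E] [NormedSpace ℝ E] {H : Type*} [TopologicalSpace H]
  {I : ModelWithCorners ℝ E H} {M : Type*} [TopologicalSpace M] [ChartedSpace H M]

/-- The point x is kept apart from `c 0` because in the applications, such as g * c 0 = g, they
agree only propositionally. -/
theorem deriv_comp_curve {c : ℝ → M} {x : M} (hx : c 0 = x) {L : ℝ →L[ℝ] E}
    (hc : HasMFDerivAt 𝓘(ℝ, ℝ) I c 0 L) {f : M → ℝ} (hf : MDifferentiableAt I 𝓘(ℝ, ℝ) f x) :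
    deriv (fun t => f (c t)) 0 = mvfderiv I f x (L 1 : E) := by
  subst hx
  have h : HasFDerivAt (fun t => f (c t))
      (ContinuousLinearMap.comp (mvfderiv I f (c 0) : E →L[ℝ] ℝ) L) 0 :=
    (HasMFDerivAt.comp (0 : ℝ) hf.hasMFDerivAt hc).hasFDerivAt
  exact h.hasDerivAt.deriv

/-- The family of curves `Φ x` through the points `x` represents the vector field `X`. -/
structure RepresentedBy (X : ∀ x : M, TangentSpace I x) (Φ : M → ℝ → M) : Prop where
  contMDiffAt (x : M) : ContMDiffAt (I.prod 𝓘(ℝ, ℝ)) I ∞ (Function.uncurry Φ) (x, 0)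
  dirDeriv_eq (f : M → ℝ) (hf : ContMDiff I 𝓘(ℝ, ℝ) ∞ f) (x : M) :
    dirDeriv X f x = deriv (fun t => f (Φ x t)) 0

/-- X f is the t-derivative at 0 of the function f (Φ y t), which is jointly smooth near (x, 0). -/
theorem RepresentedBy.isSmoothVectorField [IsManifold I 1 M] {X : ∀ x : M, TangentSpace I x}
    {Φ : M → ℝ → M} (h : RepresentedBy X Φ) : IsSmoothVectorField X := by
  intro f hf x
  have h1 : ContMDiffAt (I.prod 𝓘(ℝ, ℝ)) 𝓘(ℝ, ℝ) ∞
      (Function.uncurry fun (y : M) (t : ℝ) => f (Φ y t)) (x, 0) :=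
    (hf _).comp (x, (0 : ℝ)) (h.contMDiffAt x)
  have h2 := ContMDiffAt.mfderiv (m := ∞) (fun (y : M) (t : ℝ) => f (Φ y t)) (fun _ : M => (0 : ℝ))
    h1 contMDiffAt_const (by norm_cast)
  have h3 : ContMDiffAt I 𝓘(ℝ, ℝ →L[ℝ] ℝ) ∞
      (fun y : M => fderiv ℝ (fun t : ℝ => f (Φ y t)) 0) x := by
    simpa only [inTangentCoordinates_model_space, mfderiv_eq_fderiv] using! h2
  have h4 : dirDeriv X f = fun y => fderiv ℝ (fun t : ℝ => f (Φ y t)) 0 1 := by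
    ext y
    rw [h.dirDeriv_eq f hf, ← fderiv_apply_one_eq_deriv]
  rw [h4]
  exact h3.clm_apply contMDiffAt_const

/-- The two iterated derivatives are the mixed partials at the origin of f (Φ (Ψ x s) t). The
families need not be flows: it is enough that they commute with each other. -/
theorem RepresentedBy.commute [IsManifold I 1 M] {X Y : ∀ x : M, TangentSpace I x}
    {Φ Ψ : M → ℝ → M} (hX : RepresentedBy X Φ) (hY : RepresentedBy Y Ψ)
    (h : ∀ x s t, Φ (Ψ x s) t = Ψ (Φ x t) s) : CommuteVectorField X Y := by
  intro f hf x
  have hXf := hX.isSmoothVectorField f hf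
  have hYf := hY.isSmoothVectorField f hf
  rw [hX.dirDeriv_eq _ hYf, hY.dirDeriv_eq _ hXf]
  simp only [hX.dirDeriv_eq f hf, hY.dirDeriv_eq f hf]
  have h1 : ContMDiffAt 𝓘(ℝ, ℝ × ℝ) I ∞ (fun p : ℝ × ℝ => Ψ x p.1) (0, 0) :=
    ContMDiffAt.comp (g := Function.uncurry Ψ) (f := fun p : ℝ × ℝ => (x, p.1)) ((0 : ℝ), (0 : ℝ))
      (hY.contMDiffAt x) (contMDiffAt_const.prodMk contDiff_fst.contMDiff.contMDiffAt)
  have h2 : ContMDiffAt 𝓘(ℝ, ℝ × ℝ) I ∞ (fun p : ℝ × ℝ => Φ (Ψ x p.1) p.2) (0, 0) :=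
    ContMDiffAt.comp (g := Function.uncurry Φ) (f := fun p : ℝ × ℝ => (Ψ x p.1, p.2))
      ((0 : ℝ), (0 : ℝ)) (hX.contMDiffAt _) (h1.prodMk contDiff_snd.contMDiff.contMDiffAt)
  have h3 : ContDiffAt ℝ ∞ (fun p : ℝ × ℝ => f (Φ (Ψ x p.1) p.2)) (0, 0) :=
    ((hf _).comp ((0 : ℝ), (0 : ℝ)) h2).contDiffAt
  have h4 := deriv_deriv_comm h3
  simp only [h] at h4 ⊢
  exact h4.symm

end VectorFieldsFromCurves

/-! ### Invariant vector fields on a Lie group. -/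

noncomputable section InvariantFields

variable {E : Type*} [NormedAddCommGroup E] [NormedSpace ℝ E] {H : Type*} [TopologicalSpace H]
  {I : ModelWithCorners ℝ E H} {G : Type*} [Group G] [TopologicalSpace G] [ChartedSpace H G]

/-- The left-invariant vector field with a given value at the identity. -/
def leftVectorField (v : GroupLieAlgebra I G) (g : G) : TangentSpace I g :=
  (mfderiv I I (fun h : G => g * h) 1 v : E)

/-- The right-invariant vector field with a given value at the identity. -/
def rightVectorField (v : GroupLieAlgebra I G) (g : G) : TangentSpace I g :=
  (mfderiv I I (fun h : G => h * g) 1 v : E)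

theorem leftInvariantField_ιMulti {p : ℕ} (v : Fin p → GroupLieAlgebra I G) :
    leftInvariantField (exteriorPower.ιMulti ℝ p v) = wedgeField fun i => leftVectorField (v i) := by
  ext1 g
  exact exteriorPower.map_apply_ιMulti _ _

theorem rightInvariantField_ιMulti {p : ℕ} (v : Fin p → GroupLieAlgebra I G) :
    rightInvariantField (exteriorPower.ιMulti ℝ p v) =
      wedgeField fun i => rightVectorField (v i) := by
  ext1 g
  exact exteriorPower.map_apply_ιMulti _ _

/-- Any smooth curve through 1 with velocity v will do; it need not be a one-parameter subgroup. -/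
theorem leftVectorField_representedBy [LieGroup I ∞ G] {v : GroupLieAlgebra I G} {c : ℝ → G}
    (hc : ContMDiffAt 𝓘(ℝ, ℝ) I ∞ c 0) (hc0 : c 0 = 1)
    (hv : mfderiv 𝓘(ℝ, ℝ) I c 0 1 = (v : E)) :
    RepresentedBy (I := I) (leftVectorField v) fun g t => g * c t where
  contMDiffAt g := by
    have h1 : ContMDiffAt (I.prod 𝓘(ℝ, ℝ)) I ∞ (fun p : G × ℝ => c p.2) (g, 0) :=
      ContMDiffAt.comp (g := c) (f := fun p : G × ℝ => p.2) (g, (0 : ℝ)) hc contMDiffAt_snd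
    exact contMDiffAt_fst.mul h1
  dirDeriv_eq f hf g := by
    have hm : MDifferentiableAt I I (fun h : G => g * h) (c 0) :=
      (contMDiff_mul_left (I := I) (n := ∞) (a := g)).mdifferentiableAt (by simp)
    have h1 := HasMFDerivAt.comp (0 : ℝ) hm.hasMFDerivAt
      (hc.mdifferentiableAt (by simp)).hasMFDerivAt
    have h2 := deriv_comp_curve (x := g) (by simp [hc0]) h1 (hf.mdiffAt_real g)
    refine Eq.trans ?_ h2.symm
    have h3 : (mfderiv I I (fun h : G => g * h) 1 (v : E) : E) =
        mfderiv I I (fun h : G => g * h) (c 0) (mfderiv 𝓘(ℝ, ℝ) I c 0 1 : E) := by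
      rw [hv, hc0]
    exact congrArg (fun w : E => mvfderiv I f g w) h3

theorem rightVectorField_representedBy [LieGroup I ∞ G] {v : GroupLieAlgebra I G} {c : ℝ → G}
    (hc : ContMDiffAt 𝓘(ℝ, ℝ) I ∞ c 0) (hc0 : c 0 = 1)
    (hv : mfderiv 𝓘(ℝ, ℝ) I c 0 1 = (v : E)) :
    RepresentedBy (I := I) (rightVectorField v) fun g t => c t * g where
  contMDiffAt g := by
    have h1 : ContMDiffAt (I.prod 𝓘(ℝ, ℝ)) I ∞ (fun p : G × ℝ => c p.2) (g, 0) :=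
      ContMDiffAt.comp (g := c) (f := fun p : G × ℝ => p.2) (g, (0 : ℝ)) hc contMDiffAt_snd
    exact h1.mul contMDiffAt_fst
  dirDeriv_eq f hf g := by
    have hm : MDifferentiableAt I I (fun h : G => h * g) (c 0) :=
      (contMDiff_mul_right (I := I) (n := ∞) (a := g)).mdifferentiableAt (by simp)
    have h1 := HasMFDerivAt.comp (0 : ℝ) hm.hasMFDerivAt
      (hc.mdifferentiableAt (by simp)).hasMFDerivAt
    have h2 := deriv_comp_curve (x := g) (by simp [hc0]) h1 (hf.mdiffAt_real g)
    refine Eq.trans ?_ h2.symm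
    have h3 : (mfderiv I I (fun h : G => h * g) 1 (v : E) : E) =
        mfderiv I I (fun h : G => h * g) (c 0) (mfderiv 𝓘(ℝ, ℝ) I c 0 1 : E) := by
      rw [hv, hc0]
    exact congrArg (fun w : E => mvfderiv I f g w) h3

/-- On a Lie group all of whose tangent vectors at the identity are velocities of smooth curves,
`Λᴸ - Λᴿ` is a quatrisson structure for every decomposable `4`-vector `Λ`. -/
theorem isQuatrisson_left_sub_right [LieGroup I ∞ G] {v : Fin 4 → GroupLieAlgebra I G}
    (h : ∀ i, ∃ c : ℝ → G, ContMDiffAt 𝓘(ℝ, ℝ) I ∞ c 0 ∧ c 0 = 1 ∧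
      mfderiv 𝓘(ℝ, ℝ) I c 0 1 = (v i : E)) :
    IsQuatrisson (leftInvariantField (exteriorPower.ιMulti ℝ 4 v) -
      rightInvariantField (exteriorPower.ιMulti ℝ 4 v)) := by
  choose c hc hc0 hv using h
  have hL := fun i => leftVectorField_representedBy (hc i) (hc0 i) (hv i)
  have hR := fun i => rightVectorField_representedBy (hc i) (hc0 i) (hv i)
  have : IsManifold I 1 G := IsManifold.of_le (n := ∞) (by norm_cast)
  rw [leftInvariantField_ιMulti, rightInvariantField_ιMulti]
  -- Left-invariant fields move points by right multiplication and right-invariant ones by left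
  -- multiplication, so the families of curves commute by associativity.
  exact isQuatrisson_wedgeField_sub (fun i => (hL i).isSmoothVectorField)
    (fun i => (hR i).isSmoothVectorField)
    fun i j => (hL i).commute (hR j) fun x s t => mul_assoc _ _ _

end InvariantFields

/-! ### Curves in the unitary group, and the quatrisson structure on Sp(2). -/

noncomputable section CayleyCurves

variable {A : Type*} [NormedRing A] [NormedAlgebra ℝ A] [StarRing A] [StarModule ℝ A]
  [ContinuousStar A] [CompleteSpace A]

/-- The curve is t ↦ cayley (t v): the factor 1/2 in the Cayley transform makes its derivative at 0
the identity. -/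
theorem exists_curve_unitary (v : skewAdjoint.submodule ℝ A) :
    ∃ c : ℝ → unitary A, ContMDiffAt 𝓘(ℝ, ℝ) 𝓘(ℝ, skewAdjoint.submodule ℝ A) ∞ c 0 ∧ c 0 = 1 ∧
      mfderiv 𝓘(ℝ, ℝ) 𝓘(ℝ, skewAdjoint.submodule ℝ A) c 0 1 = v := by
  have h0 : IsUnit (1 - (1 / 2 : ℝ) • (((0 : ℝ) • v : skewAdjoint.submodule ℝ A) : A)) := by simp
  have hev : (fun t : ℝ => (cayleyUnitary (t • v) : A)) =ᶠ[nhds 0]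
      fun t : ℝ => cayley (t • (v : A)) := by
    have hcont : ContinuousAt (fun t : ℝ => 1 - (1 / 2 : ℝ) • (t • (v : A))) 0 := by fun_prop
    filter_upwards [hcont.preimage_mem_nhds (Units.isOpen.mem_nhds h0)] with t ht
    exact coe_cayleyUnitary ht
  have hd : ContDiffAt ℝ ∞ (fun t : ℝ => cayley (t • (v : A))) 0 :=
    ContDiffAt.comp (g := cayley) (f := fun t : ℝ => t • (v : A)) (0 : ℝ)
      (contDiffAt_cayley h0) (contDiffAt_id.smul contDiffAt_const)
  have hc0 : cayleyUnitary ((0 : ℝ) • v) = 1 := by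
    ext
    rw [coe_cayleyUnitary h0]
    simp [cayley]
  have hsm : ContMDiffAt 𝓘(ℝ, ℝ) 𝓘(ℝ, skewAdjoint.submodule ℝ A) ∞
      (fun t : ℝ => cayleyUnitary (t • v)) 0 :=
    contMDiffAt_unitary_of_coe (hd.congr_of_eventuallyEq hev).contMDiffAt
  refine ⟨fun t => cayleyUnitary (t • v), hsm, hc0, ?_⟩
  -- The velocity is computed in A, since the derivative of the inclusion at 1 is the injective
  -- inclusion of skew-adjoint elements.
  have h1 := hasMFDerivAt_unitary_coe_one (A := A)
  rw [← hc0] at h1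
  obtain ⟨D, hD⟩ : ∃ D : ℝ →L[ℝ] skewAdjoint.submodule ℝ A, HasMFDerivAt 𝓘(ℝ, ℝ)
      𝓘(ℝ, skewAdjoint.submodule ℝ A) (fun t : ℝ => cayleyUnitary (t • v)) 0 D :=
    ⟨_, (hsm.mdifferentiableAt (by simp)).hasMFDerivAt⟩
  have h2 : HasFDerivAt (fun t : ℝ => (cayleyUnitary (t • v) : A))
      ((skewAdjoint.submodule ℝ A).subtypeL.comp D) 0 :=
    (HasMFDerivAt.comp (0 : ℝ) h1 hD).hasFDerivAt
  have h3 : HasFDerivAt (fun t : ℝ => cayley (t • (v : A)))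
      ((ContinuousLinearMap.id ℝ A).comp ((ContinuousLinearMap.id ℝ ℝ).smulRight (v : A))) 0 := by
    refine HasFDerivAt.comp (g := cayley) (f := fun t : ℝ => t • (v : A)) (0 : ℝ) ?_ ?_
    · rw [zero_smul]; exact hasFDerivAt_cayley_zero
    · exact (hasFDerivAt_id (0 : ℝ)).smul_const (v : A)
  have h4 := DFunLike.congr_fun (h2.unique (h3.congr_of_eventuallyEq hev)) (1 : ℝ)
  have h5 : D 1 = v := Subtype.ext (h4.trans (by simp))
  rw [hD.mfderiv]
  exact h5

end CayleyCurves

theorem isQuatrisson_bruhatFieldSp2 : IsQuatrisson bruhatFieldSp2 := by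
  rw [bruhatFieldSp2, bruhatLambda, exteriorPower.map_apply_ιMulti]
  exact isQuatrisson_left_sub_right fun i => exists_curve_unitary _

/-! ### The coset space as a smooth quotient and as a projective line. -/

noncomputable section QuaternionicLineSmooth

/-- The inclusion of quaternions as matrices with a single nonzero entry. -/
def QMat.singleL (i j : Fin 2) : ℍ[ℝ] →L[ℝ] QMat :=
  LinearMap.toContinuousLinearMap
    { toFun := fun q => QMat.of fun a b => if a = i ∧ b = j then q else 0
      map_add' := fun p q => by ext1 a b; simp only [QMat.entry_of, QMat.entry_add]; split_ifs <;> simp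
      map_smul' := fun r q => by
        ext1 a b
        simp only [QMat.entry_of, QMat.entry_smul, RingHom.id_apply]; split_ifs <;> simp }

theorem QMat.singleL_apply (i j : Fin 2) (q : ℍ[ℝ]) :
    QMat.singleL i j q = QMat.of fun a b => if a = i ∧ b = j then q else 0 := rfl

theorem QMat.eq_sum_singleL (g : QMat) : g = QMat.singleL 0 0 (g.entry 0 0) +
    QMat.singleL 0 1 (g.entry 0 1) + QMat.singleL 1 0 (g.entry 1 0) +
    QMat.singleL 1 1 (g.entry 1 1) := by
  ext1 a b
  simp only [QMat.entry_add, QMat.singleL_apply, QMat.entry_of]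
  fin_cases a <;> fin_cases b <;> simp

/-- `QMat` carries an operator norm, not the norm of a product, so a matrix is rebuilt from its
entries by the continuous linear maps `QMat.singleL`. -/
theorem QMat.contDiff_of_entry {F : Type*} [NormedAddCommGroup F] [NormedSpace ℝ F] {n : ℕ∞ω}
    {f : F → QMat} (h : ∀ i j, ContDiff ℝ n fun x => (f x).entry i j) : ContDiff ℝ n f := by
  have h1 : f = fun x => QMat.singleL 0 0 ((f x).entry 0 0) +
      QMat.singleL 0 1 ((f x).entry 0 1) + QMat.singleL 1 0 ((f x).entry 1 0) +
      QMat.singleL 1 1 ((f x).entry 1 1) := funext fun x => QMat.eq_sum_singleL (f x)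
  rw [h1]
  have h2 := fun i j => (QMat.singleL i j).contDiff.comp (h i j)
  exact (((h2 0 0).add (h2 0 1)).add (h2 1 0)).add (h2 1 1)

theorem contDiff_quaternion_normSq {n : ℕ∞ω} : ContDiff ℝ n fun q : ℍ[ℝ] => Quaternion.normSq q := by
  simp only [Quaternion.normSq_eq_norm_mul_self]
  have : ContDiff ℝ n fun q : ℍ[ℝ] => ‖q‖ ^ 2 := contDiff_norm_sq ℝ
  simpa only [pow_two] using this

theorem contDiff_quaternion_star {n : ℕ∞ω} : ContDiff ℝ n fun q : ℍ[ℝ] => star q :=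
  (starL' ℝ : ℍ[ℝ] ≃L[ℝ] ℍ[ℝ]).contDiff

theorem one_add_normSq_pos (q : ℍ[ℝ]) : 0 < 1 + Quaternion.normSq q := by
  have := Quaternion.normSq_nonneg (a := q)
  linarith

theorem contMDiff_affineSection (i : Fin 2) :
    ContMDiff 𝓘(ℝ, ℍ[ℝ]) 𝓘(ℝ, sp2) ∞ (affineSection i) := by
  intro q
  refine contMDiffAt_unitary_of_coe (ContDiffAt.contMDiffAt (ContDiff.contDiffAt ?_))
  refine QMat.contDiff_of_entry fun a b => ?_
  simp only [entry_affineSection]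
  have h1 : ContDiff ℝ ∞ fun q : ℍ[ℝ] => (√(1 + Quaternion.normSq q))⁻¹ :=
    ((contDiff_const.add contDiff_quaternion_normSq).sqrt fun q => (one_add_normSq_pos q).ne').inv
      fun q => (Real.sqrt_pos.2 (one_add_normSq_pos q)).ne'
  refine h1.smul ?_
  have := contDiff_quaternion_star (n := ∞)
  split_ifs
  · exact contDiff_const
  · exact contDiff_id
  · exact this.neg
  · exact contDiff_const

theorem contMDiff_entry (i j : Fin 2) :
    ContMDiff 𝓘(ℝ, sp2) 𝓘(ℝ, ℍ[ℝ]) ∞ fun g : Sp2 => QMat.entry g i j :=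
  (QMat.entryL i j).contDiff.contMDiff.comp contMDiff_unitary_coe

theorem contMDiffAt_affineCoord {i : Fin 2} {g : Sp2} (h : QMat.entry g 0 i ≠ 0) :
    ContMDiffAt 𝓘(ℝ, sp2) 𝓘(ℝ, ℍ[ℝ]) ∞ (affineCoord i) g := by
  have h1 : ContDiffAt ℝ ∞ (fun q : ℍ[ℝ] => q⁻¹) (QMat.entry g 0 i) := by
    have := contDiffAt_ringInverse (n := ∞) ℝ (Units.mk0 _ h)
    simpa only [Ring.inverse_eq_inv'] using! this
  have h2 : ContDiff ℝ ∞ fun p : ℍ[ℝ] × ℍ[ℝ] => p.1 * p.2 := contDiff_mul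
  exact ContMDiffAt.comp (g := fun p : ℍ[ℝ] × ℍ[ℝ] => p.1 * p.2)
    (f := fun g : Sp2 => ((QMat.entry g 0 i)⁻¹, QMat.entry g 0 (i + 1))) g
    h2.contMDiff.contMDiffAt
    ((h1.contMDiffAt.comp g (contMDiff_entry 0 i g)).prodMk_space (contMDiff_entry 0 (i + 1) g))

theorem contMDiff_projHP1 : ContMDiff 𝓘(ℝ, sp2) 𝓘(ℝ, ℍ[ℝ]) ∞ projHP1 := by
  intro g
  rw [contMDiffAt_iff_target]
  refine ⟨continuous_projHP1.continuousAt, ?_⟩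
  have h := (exists_mem_affineSource (projHP1 g)).choose_spec
  exact contMDiffAt_affineCoord (proj_mem_affineSource.1 h)

theorem contMDiffAt_affineCoordHP1 {i : Fin 2} {x : HP1} (h : x ∈ affineSource i) :
    ContMDiffAt 𝓘(ℝ, ℍ[ℝ]) 𝓘(ℝ, ℍ[ℝ]) ∞ (affineCoordHP1 i) x :=
  contMDiffAt_of_mem_maximalAtlas (e := affineChart i)
    (IsManifold.subset_maximalAtlas (Set.mem_range_self i)) h

theorem projHP1_mul_of_mem {k : Sp2} (hk : k ∈ spheroid) (g : Sp2) :
    projHP1 (k * g) = projHP1 g := by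
  rw [eq_comm, proj_eq_iff]
  simpa using hk

theorem exists_entry_ne_zero (g : Sp2) : ∃ i, QMat.entry g 0 i ≠ 0 := by
  obtain ⟨i, hi⟩ := exists_mem_affineSource (projHP1 g)
  exact ⟨i, proj_mem_affineSource.1 hi⟩

/-- An affine section meets the coset of g at some representative; left multiplication by a suitable
k in the spheroid moves it to g itself without changing any coset. -/
theorem exists_local_section (g : Sp2) : ∃ S : HP1 → Sp2,
    ContMDiffAt 𝓘(ℝ, ℍ[ℝ]) 𝓘(ℝ, sp2) ∞ S (projHP1 g) ∧ S (projHP1 g) = g ∧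
      projHP1 ∘ S =ᶠ[nhds (projHP1 g)] id := by
  obtain ⟨i, hi⟩ := exists_entry_ne_zero g
  set k : Sp2 := g * (affineSection i (affineCoord i g))⁻¹ with hkdef
  have hk : k ∈ spheroid := proj_eq_iff.1 (proj_affineSection hi)
  have hmem : projHP1 g ∈ affineSource i := proj_mem_affineSource.2 hi
  refine ⟨fun x => k * affineSection i (affineCoordHP1 i x), ?_, ?_, ?_⟩
  · have h1 : ContMDiffAt 𝓘(ℝ, ℍ[ℝ]) 𝓘(ℝ, sp2) ∞
        (fun x => affineSection i (affineCoordHP1 i x)) (projHP1 g) :=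
      (contMDiff_affineSection i _).comp _ (contMDiffAt_affineCoordHP1 hmem)
    exact contMDiffAt_const.mul h1
  · change k * affineSection i (affineCoord i g) = g
    rw [hkdef, inv_mul_cancel_right]
  · filter_upwards [(affineChart i).open_source.mem_nhds hmem] with x hx
    rw [Function.comp_apply, projHP1_mul_of_mem hk]
    exact (affineChart i).left_inv hx

/-- Near each point F is the composite of F ∘ p with a local section. -/
theorem contMDiff_of_comp_projHP1 {E' : Type*} [NormedAddCommGroup E'] [NormedSpace ℝ E']
    {H' : Type*} [TopologicalSpace H'] {J : ModelWithCorners ℝ E' H'} {N : Type*}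
    [TopologicalSpace N] [ChartedSpace H' N] {F : HP1 → N}
    (hF : ContMDiff 𝓘(ℝ, sp2) J ∞ (F ∘ projHP1)) : ContMDiff 𝓘(ℝ, ℍ[ℝ]) J ∞ F := by
  intro x
  obtain ⟨g, rfl⟩ := projHP1_surjective x
  obtain ⟨S, hS, -, hpS⟩ := exists_local_section g
  refine ((hF _).comp _ hS).congr_of_eventuallyEq ?_
  filter_upwards [hpS] with y hy
  exact congrArg F hy.symm

/-- Differentiating p ∘ S = id gives a right inverse of the derivative; that S passes through g
itself makes this the derivative at g. -/
theorem surjective_mfderiv_projHP1 (g : Sp2) :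
    Function.Surjective (mfderiv 𝓘(ℝ, sp2) 𝓘(ℝ, ℍ[ℝ]) projHP1 g) := by
  obtain ⟨S, hS, hSg, hpS⟩ := exists_local_section g
  intro v
  have h1 := mfderiv_comp (projHP1 g) (contMDiff_projHP1.mdifferentiableAt (x := S (projHP1 g))
    (by simp)) (hS.mdifferentiableAt (by simp))
  rw [hpS.mfderiv_eq, mfderiv_id] at h1
  refine ⟨(mfderiv 𝓘(ℝ, ℍ[ℝ]) 𝓘(ℝ, sp2) S (projHP1 g) (v : ℍ[ℝ]) : sp2), ?_⟩
  have h2 : (v : ℍ[ℝ]) = (mfderiv 𝓘(ℝ, sp2) 𝓘(ℝ, ℍ[ℝ]) projHP1 (S (projHP1 g))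
      (mfderiv 𝓘(ℝ, ℍ[ℝ]) 𝓘(ℝ, sp2) S (projHP1 g) (v : ℍ[ℝ])) : ℍ[ℝ]) :=
    DFunLike.congr_fun h1 v
  rw [hSg] at h2
  exact h2.symm

theorem rightTranslate_contMDiff (s : Sp2) :
    ContMDiff 𝓘(ℝ, ℍ[ℝ]) 𝓘(ℝ, ℍ[ℝ]) ∞ (rightTranslate s) := by
  refine contMDiff_of_comp_projHP1 ?_
  exact contMDiff_projHP1.comp (contMDiff_mul_right (I := 𝓘(ℝ, sp2)) (n := ∞) (a := s))

theorem first_row_ne_zero (g : Sp2) : (fun j => QMat.entry g 0 j) ≠ 0 := by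
  obtain ⟨i, hi⟩ := exists_entry_ne_zero g
  exact fun h => hi (congrFun h i)

/-- The coset of `g` as the line spanned by the first row of `g`. -/
def hp1ToProjectivization : HP1 → Projectivization ℍ[ℝ] (Fin 2 → ℍ[ℝ]) :=
  Quotient.lift (fun g => Projectivization.mk ℍ[ℝ] (fun j => QMat.entry g 0 j)
    (first_row_ne_zero g)) fun g h hr => by
    obtain ⟨u, hu, huj⟩ := first_row_of_rel (QuotientGroup.rightRel_apply.1 hr)
    rw [eq_comm, Projectivization.mk_eq_mk_iff]
    exact ⟨Units.mk0 u hu, funext fun j => (huj j).symm⟩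

theorem hp1ToProjectivization_projHP1 (g : Sp2) : hp1ToProjectivization (projHP1 g) =
    Projectivization.mk ℍ[ℝ] (fun j => QMat.entry g 0 j) (first_row_ne_zero g) := rfl

/-- The (0, 1) entry of h g* is u times that of g g* = 1, hence zero, and a unitary matrix with that
entry zero is diagonal. -/
theorem projHP1_eq_of_first_row {g h : Sp2} {u : ℍ[ℝ]}
    (hu : ∀ j, QMat.entry h 0 j = u * QMat.entry g 0 j) : projHP1 g = projHP1 h := by
  rw [proj_eq_iff]
  apply mem_spheroid_of_entry
  have h1 := congrArg (fun m => QMat.entry m 0 1) (Unitary.mem_iff.1 g.2).2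
  simp only [QMat.entry_mul, QMat.entry_star, QMat.entry_one, zero_ne_one, if_false] at h1
  rw [← Unitary.star_eq_inv, Submonoid.coe_mul, Unitary.coe_star, QMat.entry_mul,
    QMat.entry_star, QMat.entry_star, hu, hu, mul_assoc, mul_assoc, ← mul_add, h1, mul_zero]

theorem hp1ToProjectivization_bijective : Function.Bijective hp1ToProjectivization := by
  constructor
  · intro x y hxy
    obtain ⟨g, rfl⟩ := projHP1_surjective x
    obtain ⟨h, rfl⟩ := projHP1_surjective y
    rw [hp1ToProjectivization_projHP1, hp1ToProjectivization_projHP1, eq_comm,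
      Projectivization.mk_eq_mk_iff] at hxy
    obtain ⟨u, hu⟩ := hxy
    exact projHP1_eq_of_first_row (u := u) fun j => (congrFun hu j).symm
  · intro P
    induction P using Projectivization.ind with
    | h v hv =>
      obtain ⟨i, hi⟩ := Function.ne_iff.1 hv
      have hi' : v i ≠ 0 := hi
      refine ⟨projHP1 (affineSection i ((v i)⁻¹ * v (i + 1))), ?_⟩
      rw [hp1ToProjectivization_projHP1, Projectivization.mk_eq_mk_iff]
      have h0 : (√(1 + Quaternion.normSq ((v i)⁻¹ * v (i + 1))))⁻¹ ≠ 0 :=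
        inv_ne_zero (Real.sqrt_pos.2 (one_add_normSq_pos _)).ne'
      -- The first row of the section is r (1, vᵢ⁻¹ vᵢ₊₁), with 1 in position i, which is (r vᵢ⁻¹)
      -- v.
      refine ⟨Units.mk0 ((√(1 + Quaternion.normSq ((v i)⁻¹ * v (i + 1))))⁻¹ • (v i)⁻¹)
        (smul_ne_zero h0 (inv_ne_zero hi')), funext fun j => ?_⟩
      rw [entry_affineSection, if_pos rfl, Units.smul_mk0, Pi.smul_apply, smul_eq_mul, smul_mul_assoc]
      congr 1
      split_ifs with hj
      · rw [hj, inv_mul_cancel₀ hi']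
      · have : j = i + 1 := by fin_cases i <;> fin_cases j <;> simp_all
        rw [this]

theorem exists_equiv_projectivization :
    ∃ e : HP1 ≃ Projectivization ℍ[ℝ] (Fin 2 → ℍ[ℝ]), ∀ g : Sp2,
      ∃ h : (fun j => QMat.entry g 0 j) ≠ 0,
        e (projHP1 g) = Projectivization.mk ℍ[ℝ] (fun j => QMat.entry g 0 j) h :=
  ⟨Equiv.ofBijective _ hp1ToProjectivization_bijective, fun g => ⟨first_row_ne_zero g, rfl⟩⟩

end QuaternionicLineSmooth

/-! ### Multivector fields related by a smooth map. -/

noncomputable section RelatedFields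

/-- By linearity P may be taken decomposable, and then both sides are the same determinant. -/
theorem pairingDual_ιMulti_map {V W : Type*} [AddCommGroup V] [Module ℝ V] [AddCommGroup W]
    [Module ℝ W] {p : ℕ} (w : Fin p → Module.Dual ℝ W) (L : V →ₗ[ℝ] W) (P : ⋀[ℝ]^p V) :
    exteriorPower.pairingDual ℝ W p (exteriorPower.ιMulti ℝ p w) (exteriorPower.map p L P) =
      exteriorPower.pairingDual ℝ V p (exteriorPower.ιMulti ℝ p fun i => w i ∘ₗ L) P := by
  have h : (exteriorPower.pairingDual ℝ W p (exteriorPower.ιMulti ℝ p w)) ∘ₗ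
      exteriorPower.map p L =
        exteriorPower.pairingDual ℝ V p (exteriorPower.ιMulti ℝ p fun i => w i ∘ₗ L) := by
    refine exteriorPower.linearMap_ext ?_
    ext v
    simp [exteriorPower.map_apply_ιMulti, exteriorPower.pairingDual_ιMulti_ιMulti]
  exact DFunLike.congr_fun h P

variable {E : Type*} [NormedAddCommGroup E] [NormedSpace ℝ E] {H : Type*} [TopologicalSpace H]
  {I : ModelWithCorners ℝ E H} {M : Type*} [TopologicalSpace M] [ChartedSpace H M]
  {E' : Type*} [NormedAddCommGroup E'] [NormedSpace ℝ E'] {H' : Type*} [TopologicalSpace H']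
  {J : ModelWithCorners ℝ E' H'} {N : Type*} [TopologicalSpace N] [ChartedSpace H' N]

/-- The multivector fields `P` and `Q` are related by the map `F`. -/
def RelatedBy {p : ℕ} (F : M → N) (P : MultivectorField I M p) (Q : MultivectorField J N p) :
    Prop :=
  ∀ x, pushforwardAt I J F x (P x) = Q (F x)

theorem RelatedBy.eval_comp {p : ℕ} {F : M → N} {P : MultivectorField I M p}
    {Q : MultivectorField J N p} (h : RelatedBy F P Q) (hF : ContMDiff I J ∞ F)
    {f : Fin p → N → ℝ} (hf : ∀ i, ContMDiff J 𝓘(ℝ, ℝ) ∞ (f i)) (x : M) :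
    Q.eval f (F x) = P.eval (fun i => f i ∘ F) x := by
  rw [MultivectorField.eval, ← h x, MultivectorField.eval, pushforwardAt, pairingDual_ιMulti_map]
  have h1 : ∀ i, (mvfderiv I (f i ∘ F) x).toLinearMap =
      (mvfderiv J (f i) (F x)).toLinearMap ∘ₗ (mfderiv I J F x).toLinearMap := by
    intro i
    have h2 := mfderiv_comp x ((hf i).mdiffAt_real (F x)) (hF.mdifferentiableAt (by simp))
    rw [mvfderiv, h2]
    rfl
  simp only [h1]

/-- Relatedness is used twice: for the outer evaluation, and for the inner function `Q.eval f`,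
whose pullback is an evaluation of P. Smoothness of Q makes that inner function an admissible
argument. -/
theorem RelatedBy.insertion_comp {F : M → N} {P : MultivectorField I M 4}
    {Q : MultivectorField J N 4} (h : RelatedBy F P Q) (hF : ContMDiff I J ∞ F) (hQ : Q.IsSmooth)
    {f : Fin 7 → N → ℝ} (hf : ∀ i, ContMDiff J 𝓘(ℝ, ℝ) ∞ (f i)) (x : M) :
    MultivectorField.insertion (p := 3) (q := 3) Q Q f (F x) =
      MultivectorField.insertion (p := 3) (q := 3) P P (fun i => f i ∘ F) x := by
  simp only [MultivectorField.insertion]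
  congr 1
  refine Finset.sum_congr rfl fun σ _ => ?_
  congr 1
  rw [h.eval_comp hF]
  · congr 1
    ext i : 1
    refine Fin.cases ?_ (fun j => rfl) i
    exact funext fun y => h.eval_comp hF (fun i => hf _) y
  · intro i
    refine Fin.cases ?_ (fun j => hf _) i
    exact hQ _ fun i => hf _

/-- Every point of N is some F x, and there the bracket of Q on functions f is the bracket of P on
the pullbacks f ∘ F. The hypothesis `hdesc` serves only to make Q smooth. -/
theorem RelatedBy.isQuatrisson {F : M → N} {P : MultivectorField I M 4}
    {Q : MultivectorField J N 4} (h : RelatedBy F P Q) (hF : ContMDiff I J ∞ F)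
    (hsurj : Function.Surjective F)
    (hdesc : ∀ u : N → ℝ, ContMDiff I 𝓘(ℝ, ℝ) ∞ (u ∘ F) → ContMDiff J 𝓘(ℝ, ℝ) ∞ u)
    (hP : IsQuatrisson P) : IsQuatrisson Q := by
  have hQ : Q.IsSmooth := by
    intro f hf
    refine hdesc _ ?_
    have h1 : Q.eval f ∘ F = P.eval fun i => f i ∘ F := funext fun x => h.eval_comp hF hf x
    rw [h1]
    exact hP.1 _ fun i => (hf i).comp hF
  refine ⟨hQ, fun f hf y => ?_⟩
  obtain ⟨x, rfl⟩ := hsurj y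
  have h0 : MultivectorField.eval (0 : MultivectorField J N (3 + 3 + 1)) f (F x) = 0 := map_zero _
  have h0' : MultivectorField.eval (0 : MultivectorField I M (3 + 3 + 1)) (fun i => f i ∘ F) x =
    0 := map_zero _
  have h1 := hP.2 (fun i => f i ∘ F) (fun i => (hf i).comp hF) x
  have h2 := h.insertion_comp hF hQ hf x
  rw [h0'] at h1
  rw [h0]
  change 0 = _ * MultivectorField.insertion (p := 3) (q := 3) Q Q f (F x) -
    _ * MultivectorField.insertion (p := 3) (q := 3) Q Q f (F x)
  rw [h2]
  exact h1

end RelatedFields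

/-! ### Invariance of Λ under the adjoint action of the spheroid. -/

noncomputable section SpheroidInvariance

/-- An alternating map of top degree, even with values in a module, is determined by its value on a
basis: it is `e.det` times that value. -/
theorem alternatingMap_apply_comp_basis {V N : Type*} [AddCommGroup V] [Module ℝ V]
    [AddCommGroup N] [Module ℝ N] {n : ℕ} (e : Module.Basis (Fin n) ℝ V)
    (f : V [⋀^Fin n]→ₗ[ℝ] N) (T : V →ₗ[ℝ] V) :
    f (fun i => T (e i)) = LinearMap.det T • f e := by
  have h : f = (LinearMap.toSpanSingleton ℝ N (f e)).compAlternatingMap e.det := by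
    refine Module.Basis.ext_alternating e fun v hv => ?_
    let σ : Equiv.Perm (Fin n) := Equiv.ofBijective v (Finite.injective_iff_bijective.1 hv)
    change f (e ∘ σ) = (LinearMap.toSpanSingleton ℝ N (f e)).compAlternatingMap e.det (e ∘ σ)
    simp [AlternatingMap.map_perm, Module.Basis.det_self]
  have h1 : f (fun i => T (e i)) = e.det (T ∘ e) • f e := DFunLike.congr_fun h _
  rw [h1, Module.Basis.det_comp, Module.Basis.det_self, mul_one]

/-- The basis `1, i, j, k` of the quaternions. -/
def quaternionBasis : Module.Basis (Fin 4) ℝ ℍ[ℝ] := .ofEquivFun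
  { toFun := fun q => ![q.re, q.imI, q.imJ, q.imK]
    invFun := fun v => ⟨v 0, v 1, v 2, v 3⟩
    map_add' := fun p q => by ext i; fin_cases i <;> simp
    map_smul' := fun r q => by ext i; fin_cases i <;> simp
    left_inv := fun q => rfl
    right_inv := fun v => by ext i; fin_cases i <;> rfl }

theorem quaternionBasis_repr (q : ℍ[ℝ]) (i : Fin 4) :
    quaternionBasis.repr q i = ![q.re, q.imI, q.imJ, q.imK] i := rfl

theorem re_quaternionBasis (i : Fin 4) :
    (quaternionBasis i).re = (Pi.single i 1 : Fin 4 → ℝ) 0 := by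
  rw [quaternionBasis, Module.Basis.coe_ofEquivFun]; rfl

theorem imI_quaternionBasis (i : Fin 4) :
    (quaternionBasis i).imI = (Pi.single i 1 : Fin 4 → ℝ) 1 := by
  rw [quaternionBasis, Module.Basis.coe_ofEquivFun]; rfl

theorem imJ_quaternionBasis (i : Fin 4) :
    (quaternionBasis i).imJ = (Pi.single i 1 : Fin 4 → ℝ) 2 := by
  rw [quaternionBasis, Module.Basis.coe_ofEquivFun]; rfl

theorem imK_quaternionBasis (i : Fin 4) :
    (quaternionBasis i).imK = (Pi.single i 1 : Fin 4 → ℝ) 3 := by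
  rw [quaternionBasis, Module.Basis.coe_ofEquivFun]; rfl

theorem det_quaternion_mulLeft (a : ℍ[ℝ]) :
    LinearMap.det (LinearMap.mulLeft ℝ a) = Quaternion.normSq a ^ 2 := by
  rw [← LinearMap.det_toMatrix quaternionBasis]
  have h : LinearMap.toMatrix quaternionBasis
      quaternionBasis (LinearMap.mulLeft ℝ a) =
      !![a.re, -a.imI, -a.imJ, -a.imK; a.imI, a.re, -a.imK, a.imJ;
        a.imJ, a.imK, a.re, -a.imI; a.imK, -a.imJ, a.imI, a.re] := by
    ext i j
    rw [LinearMap.toMatrix_apply, quaternionBasis_repr, LinearMap.mulLeft_apply,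
      Quaternion.re_mul, Quaternion.imI_mul, Quaternion.imJ_mul, Quaternion.imK_mul,
      re_quaternionBasis, imI_quaternionBasis, imJ_quaternionBasis, imK_quaternionBasis]
    fin_cases i <;> fin_cases j <;> simp
  rw [h, Quaternion.normSq_def', Matrix.det_succ_row_zero]
  simp [Fin.sum_univ_succ, Matrix.det_fin_three, Fin.succAbove]
  ring

theorem det_quaternion_mulRight (a : ℍ[ℝ]) :
    LinearMap.det (LinearMap.mulRight ℝ a) = Quaternion.normSq a ^ 2 := by
  rw [← LinearMap.det_toMatrix quaternionBasis]
  have h : LinearMap.toMatrix quaternionBasis quaternionBasis (LinearMap.mulRight ℝ a) =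
      !![a.re, -a.imI, -a.imJ, -a.imK; a.imI, a.re, a.imK, -a.imJ;
        a.imJ, -a.imK, a.re, a.imI; a.imK, a.imJ, -a.imI, a.re] := by
    ext i j
    rw [LinearMap.toMatrix_apply, quaternionBasis_repr, LinearMap.mulRight_apply,
      Quaternion.re_mul, Quaternion.imI_mul, Quaternion.imJ_mul, Quaternion.imK_mul,
      re_quaternionBasis, imI_quaternionBasis, imJ_quaternionBasis, imK_quaternionBasis]
    fin_cases i <;> fin_cases j <;> simp
  rw [h, Quaternion.normSq_def', Matrix.det_succ_row_zero]
  simp [Fin.sum_univ_succ, Matrix.det_fin_three, Fin.succAbove]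
  ring

/-- The quaternion `x` as the matrix `(0, x; -x̄, 0)` in `𝔰𝔭(2)`. -/
def offDiagonal : ℍ[ℝ] →ₗ[ℝ] sp2 where
  toFun x := ⟨QMat.of ![![0, x], ![-star x, 0]], by
    rw [skewAdjoint.submodule, Submodule.mem_mk]
    refine skewAdjoint.mem_iff.2 ?_
    ext1 a b; fin_cases a <;> fin_cases b <;> simp⟩
  map_add' x y := by
    apply Subtype.ext
    rw [Submodule.coe_add]
    ext1 a b; fin_cases a <;> fin_cases b <;> simp [add_comm]
  map_smul' r x := by
    apply Subtype.ext
    rw [RingHom.id_apply, Submodule.coe_smul]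
    ext1 a b; fin_cases a <;> fin_cases b <;> simp

/-- The quaternion 1 gives E, and -x̄ = x for imaginary x gives S_x. So Λ is the image of the volume
element of ℍ. -/
theorem bruhatLambda_eq : bruhatLambda =
    exteriorPower.ιMulti ℝ 4 fun i => offDiagonal (quaternionBasis i) := by
  rw [bruhatLambda]
  congr 1
  funext i
  apply Subtype.ext
  fin_cases i <;> ext1 a b <;> fin_cases a <;> fin_cases b <;>
    simp [matE, matS, offDiagonal] <;> ext <;> simp [re_quaternionBasis, imI_quaternionBasis,
      imJ_quaternionBasis, imK_quaternionBasis]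

/-- The adjoint action of an element of the unitary group on its Lie algebra. -/
def unitaryAd {A : Type*} [NormedRing A] [NormedAlgebra ℝ A] [StarRing A] [StarModule ℝ A]
    (k : unitary A) : skewAdjoint.submodule ℝ A →ₗ[ℝ] skewAdjoint.submodule ℝ A where
  toFun X := ⟨k * X * star (k : A), by
    change _ ∈ skewAdjoint A
    refine skewAdjoint.mem_iff.2 ?_
    simp [star_coe_skew, mul_assoc]⟩
  map_add' X Y := by ext; simp [mul_add, add_mul]
  map_smul' r X := by ext; simp

/-- Conjugation is the restriction of the linear map C of A, so the two derivatives agree after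
inclusion into A, and the inclusion is injective. -/
theorem mfderiv_conj {A : Type*} [NormedRing A] [NormedAlgebra ℝ A] [StarRing A] [StarModule ℝ A]
    [ContinuousStar A] [CompleteSpace A] (k : unitary A) (X : skewAdjoint.submodule ℝ A) :
    mfderiv 𝓘(ℝ, skewAdjoint.submodule ℝ A) 𝓘(ℝ, skewAdjoint.submodule ℝ A)
      (fun h : unitary A => k * h * k⁻¹) 1 X = unitaryAd k X := by
  have hsm : ContMDiff 𝓘(ℝ, skewAdjoint.submodule ℝ A) 𝓘(ℝ, skewAdjoint.submodule ℝ A) ∞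
      (fun h : unitary A => k * h * k⁻¹) :=
    (contMDiff_const.mul contMDiff_id).mul contMDiff_const
  obtain ⟨D, hD⟩ : ∃ D : skewAdjoint.submodule ℝ A →L[ℝ] skewAdjoint.submodule ℝ A,
      HasMFDerivAt 𝓘(ℝ, skewAdjoint.submodule ℝ A) 𝓘(ℝ, skewAdjoint.submodule ℝ A)
        (fun h : unitary A => k * h * k⁻¹) 1 D :=
    ⟨_, (hsm.mdifferentiableAt (by simp)).hasMFDerivAt⟩
  have h1 := hasMFDerivAt_unitary_coe_one (A := A)
  have hk : (1 : unitary A) = k * 1 * k⁻¹ := by simp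
  rw [hk] at h1
  have h2 : HasMFDerivAt 𝓘(ℝ, skewAdjoint.submodule ℝ A) 𝓘(ℝ, A)
      (fun h : unitary A => ((k * h * k⁻¹ : unitary A) : A)) 1
      ((skewAdjoint.submodule ℝ A).subtypeL.comp D) := HasMFDerivAt.comp (1 : unitary A) h1 hD
  let C : A →L[ℝ] A := ((ContinuousLinearMap.mul ℝ A).flip (star (k : A))).comp
    (ContinuousLinearMap.mul ℝ A (k : A))
  have h3 : HasMFDerivAt 𝓘(ℝ, skewAdjoint.submodule ℝ A) 𝓘(ℝ, A)
      (fun h : unitary A => C (h : A)) 1 (C.comp (skewAdjoint.submodule ℝ A).subtypeL) :=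
    HasMFDerivAt.comp (1 : unitary A) C.hasFDerivAt.hasMFDerivAt
      (hasMFDerivAt_unitary_coe_one (A := A))
  have h4 : (skewAdjoint.submodule ℝ A).subtypeL.comp D =
      C.comp (skewAdjoint.submodule ℝ A).subtypeL := hasMFDerivAt_unique h2 h3
  have h5 : D X = unitaryAd k X := Subtype.ext (DFunLike.congr_fun h4 X)
  rw [hD.mfderiv]
  exact h5

theorem unitaryAd_offDiagonal {k : Sp2} (hk : k ∈ spheroid) (x : ℍ[ℝ]) :
    unitaryAd k (offDiagonal x) =
      offDiagonal (QMat.entry k 0 0 * x * star (QMat.entry k 1 1)) := by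
  apply Subtype.ext
  ext1 a b
  fin_cases a <;> fin_cases b <;> simp [unitaryAd, offDiagonal, hk.1, hk.2, mul_assoc]

/-- The diagonal entries a, b of k have norm 1, so x ↦ a x b̄ has determinant |a|⁴|b|⁴ = 1 and
preserves the volume element of ℍ. -/
theorem map_unitaryAd_bruhatLambda {k : Sp2} (hk : k ∈ spheroid) :
    exteriorPower.map 4 (unitaryAd k) bruhatLambda = bruhatLambda := by
  have h0 : Quaternion.normSq (QMat.entry k 0 0) = 1 := by
    have := first_row_normSq k 0
    rw [zero_add, hk.1] at this
    simpa using this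
  have h1 : Quaternion.normSq (QMat.entry k 1 1) = 1 := by
    have h := congrArg (fun m => QMat.entry m 1 1) (Unitary.mem_iff.1 k.2).2
    simp only [QMat.entry_mul, QMat.entry_star, QMat.entry_one, Quaternion.self_mul_star, hk.2,
      if_true] at h
    simpa using congrArg QuaternionAlgebra.re h
  rw [bruhatLambda_eq, exteriorPower.map_apply_ιMulti]
  have h2 := alternatingMap_apply_comp_basis quaternionBasis
    ((exteriorPower.ιMulti ℝ 4).compLinearMap offDiagonal)
    (LinearMap.mulRight ℝ (star (QMat.entry k 1 1)) ∘ₗ LinearMap.mulLeft ℝ (QMat.entry k 0 0))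
  rw [LinearMap.det_comp, det_quaternion_mulLeft, det_quaternion_mulRight, Quaternion.normSq_star,
    h0, h1] at h2
  simp only [one_pow, mul_one, one_smul] at h2
  refine Eq.trans ?_ h2
  rw [AlternatingMap.compLinearMap_apply]
  congr 1
  funext i
  exact unitaryAd_offDiagonal hk _

end SpheroidInvariance

/-! ### Multivectors at propositionally equal points, compared in the model space. -/

noncomputable section TangentModel

variable {E : Type*} [NormedAddCommGroup E] [NormedSpace ℝ E] {H : Type*} [TopologicalSpace H]
  (I : ModelWithCorners ℝ E H) {M : Type*} [TopologicalSpace M] [ChartedSpace H M]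
  {E' : Type*} [NormedAddCommGroup E'] [NormedSpace ℝ E'] {H' : Type*} [TopologicalSpace H']
  (J : ModelWithCorners ℝ E' H') {N : Type*} [TopologicalSpace N] [ChartedSpace H' N]
  {E'' : Type*} [NormedAddCommGroup E''] [NormedSpace ℝ E''] {H'' : Type*} [TopologicalSpace H'']
  (K : ModelWithCorners ℝ E'' H'') {O : Type*} [TopologicalSpace O] [ChartedSpace H'' O]

/-- The identification of a tangent space with the model space. -/
def tangentToModel (x : M) : TangentSpace I x →ₗ[ℝ] E := LinearMap.id

/-- The identification of the model space with a tangent space. -/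
def modelToTangent (x : M) : E →ₗ[ℝ] TangentSpace I x := LinearMap.id

/-- The identification of the `p`-vectors at a point with those of the model space. -/
def multivectorToModel (p : ℕ) (x : M) : ⋀[ℝ]^p (TangentSpace I x) →ₗ[ℝ] ⋀[ℝ]^p E :=
  exteriorPower.map p (tangentToModel I x)

/-- The identification of the `p`-vectors of the model space with those at a point. -/
def modelToMultivector (p : ℕ) (x : M) : ⋀[ℝ]^p E →ₗ[ℝ] ⋀[ℝ]^p (TangentSpace I x) :=
  exteriorPower.map p (modelToTangent I x)

/-- The derivative of a map, as a map of model spaces. -/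
def modelDeriv (F : M → N) (x : M) : E →ₗ[ℝ] E' :=
  tangentToModel J (F x) ∘ₗ (mfderiv I J F x).toLinearMap ∘ₗ modelToTangent I x

variable {I J K}

theorem multivectorToModel_modelToMultivector {p : ℕ} (x : M) (P : ⋀[ℝ]^p E) :
    multivectorToModel I p x (modelToMultivector I p x P) = P := by
  rw [multivectorToModel, modelToMultivector, ← LinearMap.comp_apply, ← exteriorPower.map_comp]
  have h : tangentToModel I x ∘ₗ modelToTangent I x = LinearMap.id := rfl
  rw [h, exteriorPower.map_id, LinearMap.id_apply]

theorem modelToMultivector_multivectorToModel {p : ℕ} (x : M) (P : ⋀[ℝ]^p (TangentSpace I x)) :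
    modelToMultivector I p x (multivectorToModel I p x P) = P := by
  rw [multivectorToModel, modelToMultivector, ← LinearMap.comp_apply, ← exteriorPower.map_comp]
  have h : modelToTangent I x ∘ₗ tangentToModel I x = LinearMap.id := rfl
  rw [h, exteriorPower.map_id, LinearMap.id_apply]

theorem multivectorToModel_injective (p : ℕ) (x : M) :
    Function.Injective (multivectorToModel I p x) :=
  Function.LeftInverse.injective (g := modelToMultivector I p x)
    (modelToMultivector_multivectorToModel x)

theorem multivectorToModel_pushforwardAt {p : ℕ} (F : M → N) (x : M)
    (P : ⋀[ℝ]^p (TangentSpace I x)) :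
    multivectorToModel J p (F x) (pushforwardAt I J F x P) =
      exteriorPower.map p (modelDeriv I J F x) (multivectorToModel I p x P) := by
  rw [multivectorToModel, pushforwardAt, multivectorToModel, ← LinearMap.comp_apply,
    ← exteriorPower.map_comp, ← LinearMap.comp_apply, ← exteriorPower.map_comp]
  rfl

/-- Tangent spaces at points such as g * 1 and g are different types; after passage to the model
space their multivectors can be equated without transport. -/
theorem multivectorToModel_of_eq {p : ℕ} {x y : M} (h : x = y) (P : ⋀[ℝ]^p (TangentSpace I x)) :
    multivectorToModel I p y P = multivectorToModel I p x P := by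
  subst h; rfl

/-- A chain rule in which the intermediate point and the composite map are given only up to proved
equalities. -/
theorem modelDeriv_comp {F' : N → O} {F : M → N} {F'' : M → O} {x : M} {y : N}
    (hy : F x = y) (hF'' : ∀ z, F'' z = F' (F z)) (hF' : MDifferentiableAt J K F' y)
    (hF : MDifferentiableAt I J F x) :
    modelDeriv I K F'' x = modelDeriv J K F' y ∘ₗ modelDeriv I J F x := by
  obtain rfl : F'' = F' ∘ F := funext hF''
  subst hy
  rw [modelDeriv, mfderiv_comp x hF' hF]
  rfl

variable {G : Type*} [Group G] [TopologicalSpace G] [ChartedSpace H G]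

theorem multivectorToModel_leftInvariantField {p : ℕ} (v : ⋀[ℝ]^p (GroupLieAlgebra I G)) (g : G) :
    multivectorToModel I p g (leftInvariantField v g) =
      exteriorPower.map p (modelDeriv I I (fun h : G => g * h) 1) (multivectorToModel I p 1 v) := by
  rw [← multivectorToModel_pushforwardAt]
  exact multivectorToModel_of_eq (mul_one g) _

theorem multivectorToModel_rightInvariantField {p : ℕ} (v : ⋀[ℝ]^p (GroupLieAlgebra I G)) (g : G) :
    multivectorToModel I p g (rightInvariantField v g) =
      exteriorPower.map p (modelDeriv I I (fun h : G => h * g) 1) (multivectorToModel I p 1 v) := by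
  rw [← multivectorToModel_pushforwardAt]
  exact multivectorToModel_of_eq (one_mul g) _

end TangentModel

/-! ### Descent of Λᴸ - Λᴿ to the coset space. -/

noncomputable section DescendedField

theorem multivectorToModel_bruhatLambda :
    multivectorToModel 𝓘(ℝ, sp2) 4 (1 : Sp2) (exteriorPower.map 4 sp2ToTangent bruhatLambda) =
      bruhatLambda :=
  multivectorToModel_modelToMultivector (I := 𝓘(ℝ, sp2)) (1 : Sp2) bruhatLambda

theorem modelDeriv_conj (k : Sp2) :
    modelDeriv 𝓘(ℝ, sp2) 𝓘(ℝ, sp2) (fun h : Sp2 => k * h * k⁻¹) 1 = unitaryAd k :=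
  LinearMap.ext fun X => mfderiv_conj k X

/-- The value at `F 1` of the pushforward of `Λ` by a map `F` from `Sp(2)` to `Sph \ Sp(2)`. -/
def pushLambda (F : Sp2 → HP1) : ⋀[ℝ]^4 ℍ[ℝ] :=
  exteriorPower.map 4 (modelDeriv 𝓘(ℝ, sp2) 𝓘(ℝ, ℍ[ℝ]) F 1) bruhatLambda

/-- The derivative at 1 of conjugation by k is the adjoint action, which fixes Λ. Both the descent
and the invariance of the descended field rest on this. -/
theorem pushLambda_comp_conj {k : Sp2} (hk : k ∈ spheroid) {F F' : Sp2 → HP1}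
    (hF : ContMDiff 𝓘(ℝ, sp2) 𝓘(ℝ, ℍ[ℝ]) ∞ F) (h : ∀ x, F' x = F (k * x * k⁻¹)) :
    pushLambda F' = pushLambda F := by
  have hc : ContMDiff 𝓘(ℝ, sp2) 𝓘(ℝ, sp2) ∞ (fun h : Sp2 => k * h * k⁻¹) :=
    (contMDiff_const.mul contMDiff_id).mul contMDiff_const
  have h1 := modelDeriv_comp (I := 𝓘(ℝ, sp2)) (J := 𝓘(ℝ, sp2)) (K := 𝓘(ℝ, ℍ[ℝ]))
    (F := fun h : Sp2 => k * h * k⁻¹) (F' := F) (F'' := F') (x := 1) (y := 1) (by simp)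
    h (hF.mdifferentiableAt (by simp)) (hc.mdifferentiableAt (by simp))
  rw [pushLambda, h1, exteriorPower.map_comp, LinearMap.comp_apply, modelDeriv_conj,
    map_unitaryAd_bruhatLambda hk, pushLambda]

theorem contMDiff_projHP1_mul_left (g : Sp2) :
    ContMDiff 𝓘(ℝ, sp2) 𝓘(ℝ, ℍ[ℝ]) ∞ fun h : Sp2 => projHP1 (g * h) :=
  contMDiff_projHP1.comp (contMDiff_mul_left (I := 𝓘(ℝ, sp2)) (n := ∞) (a := g))

theorem contMDiff_projHP1_mul_right (g : Sp2) :
    ContMDiff 𝓘(ℝ, sp2) 𝓘(ℝ, ℍ[ℝ]) ∞ fun h : Sp2 => projHP1 (h * g) :=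
  contMDiff_projHP1.comp (contMDiff_mul_right (I := 𝓘(ℝ, sp2)) (n := ∞) (a := g))

/-- The image of `Λᴸ - Λᴿ` at `g` in the coset space. -/
def projectedField (g : Sp2) : ⋀[ℝ]^4 ℍ[ℝ] :=
  pushLambda (fun h => projHP1 (g * h)) - pushLambda fun h => projHP1 (h * g)

/-- The chain rule absorbs the translations that define π into F. A general F covers both p and h ↦
p(h s). -/
theorem map_modelDeriv_bruhatFieldSp2 {F : Sp2 → HP1}
    (hF : ContMDiff 𝓘(ℝ, sp2) 𝓘(ℝ, ℍ[ℝ]) ∞ F) (g : Sp2) :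
    exteriorPower.map 4 (modelDeriv 𝓘(ℝ, sp2) 𝓘(ℝ, ℍ[ℝ]) F g)
        (multivectorToModel 𝓘(ℝ, sp2) 4 g (bruhatFieldSp2 g)) =
      pushLambda (fun h => F (g * h)) - pushLambda fun h => F (h * g) := by
  have h1 := modelDeriv_comp (I := 𝓘(ℝ, sp2)) (J := 𝓘(ℝ, sp2)) (K := 𝓘(ℝ, ℍ[ℝ]))
    (F := fun h : Sp2 => g * h) (F' := F) (F'' := fun h => F (g * h)) (x := 1) (y := g) (by simp)
    (fun _ => rfl) (hF.mdifferentiableAt (by simp))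
    ((contMDiff_mul_left (I := 𝓘(ℝ, sp2)) (n := ∞) (a := g)).mdifferentiableAt (by simp))
  have h2 := modelDeriv_comp (I := 𝓘(ℝ, sp2)) (J := 𝓘(ℝ, sp2)) (K := 𝓘(ℝ, ℍ[ℝ]))
    (F := fun h : Sp2 => h * g) (F' := F) (F'' := fun h => F (h * g)) (x := 1) (y := g) (by simp)
    (fun _ => rfl) (hF.mdifferentiableAt (by simp))
    ((contMDiff_mul_right (I := 𝓘(ℝ, sp2)) (n := ∞) (a := g)).mdifferentiableAt (by simp))
  rw [bruhatFieldSp2, Pi.sub_apply, map_sub, map_sub, multivectorToModel_leftInvariantField,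
    multivectorToModel_rightInvariantField, multivectorToModel_bruhatLambda, pushLambda, pushLambda,
    h1, h2, exteriorPower.map_comp, exteriorPower.map_comp, LinearMap.comp_apply,
    LinearMap.comp_apply]

/-- The first term does not see k, because p(kgh) = p(gh). In the second, p(hkg) = p(k⁻¹hk g), so
the map changes by a conjugation. -/
theorem projectedField_mul {k : Sp2} (hk : k ∈ spheroid) (g : Sp2) :
    projectedField (k * g) = projectedField g := by
  rw [projectedField, projectedField]
  congr 1
  · congr 1
    funext h
    rw [mul_assoc, projHP1_mul_of_mem hk]
  · refine pushLambda_comp_conj (spheroid.inv_mem hk) (contMDiff_projHP1_mul_right g) fun h => ?_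
    rw [inv_inv, mul_assoc, mul_assoc, projHP1_mul_of_mem (spheroid.inv_mem hk)]

theorem projectedField_eq_of_proj_eq {g g' : Sp2} (h : projHP1 g = projHP1 g') :
    projectedField g = projectedField g' := by
  have h1 := projectedField_mul (proj_eq_iff.1 h) g
  rw [inv_mul_cancel_right] at h1
  exact h1.symm

/-- The Bruhat quatrisson structure on `Sph \ Sp(2)`. -/
def bruhatFieldHP1 : MultivectorField 𝓘(ℝ, ℍ[ℝ]) HP1 4 := fun x =>
  modelToMultivector 𝓘(ℝ, ℍ[ℝ]) 4 x (projectedField (Function.surjInv projHP1_surjective x))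

theorem multivectorToModel_bruhatFieldHP1 (g : Sp2) :
    multivectorToModel 𝓘(ℝ, ℍ[ℝ]) 4 (projHP1 g) (bruhatFieldHP1 (projHP1 g)) =
      projectedField g := by
  rw [bruhatFieldHP1, multivectorToModel_modelToMultivector]
  exact projectedField_eq_of_proj_eq (Function.surjInv_eq projHP1_surjective _)

theorem relatedBy_projHP1 : RelatedBy projHP1 bruhatFieldSp2 bruhatFieldHP1 := fun g => by
  apply multivectorToModel_injective
  rw [multivectorToModel_pushforwardAt, map_modelDeriv_bruhatFieldSp2 contMDiff_projHP1,
    multivectorToModel_bruhatFieldHP1, projectedField]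

theorem isQuatrisson_bruhatFieldHP1 : IsQuatrisson bruhatFieldHP1 :=
  relatedBy_projHP1.isQuatrisson contMDiff_projHP1 projHP1_surjective
    (fun _ => contMDiff_of_comp_projHP1) isQuatrisson_bruhatFieldSp2

theorem bruhatFieldHP1_invariant {s : Sp2} (hs : s ∈ spheroid) (x : HP1) :
    pushforwardAt 𝓘(ℝ, ℍ[ℝ]) 𝓘(ℝ, ℍ[ℝ]) (rightTranslate s) x (bruhatFieldHP1 x) =
      bruhatFieldHP1 (rightTranslate s x) := by
  obtain ⟨g, rfl⟩ := projHP1_surjective x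
  have h1 := modelDeriv_comp (I := 𝓘(ℝ, sp2)) (J := 𝓘(ℝ, ℍ[ℝ])) (K := 𝓘(ℝ, ℍ[ℝ]))
    (F := projHP1) (F' := rightTranslate s) (F'' := fun h => projHP1 (h * s)) (x := g) rfl
    (fun _ => rfl) ((rightTranslate_contMDiff s).mdifferentiableAt (by simp))
    (contMDiff_projHP1.mdifferentiableAt (by simp))
  apply multivectorToModel_injective
  rw [multivectorToModel_pushforwardAt, ← relatedBy_projHP1 g, multivectorToModel_pushforwardAt,
    ← LinearMap.comp_apply, ← exteriorPower.map_comp, ← h1,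
    map_modelDeriv_bruhatFieldSp2 (contMDiff_projHP1_mul_right s), rightTranslate_projHP1,
    multivectorToModel_bruhatFieldHP1, projectedField]
  congr 1
  -- p(g h s) = p(g s (s⁻¹ h s)), so the left-invariant terms differ by a conjugation; the
  -- right-invariant terms involve the same map h ↦ p(h g s).
  · refine pushLambda_comp_conj (spheroid.inv_mem hs) (contMDiff_projHP1_mul_left (g * s))
      fun h => ?_
    simp [mul_assoc]
  · simp only [mul_assoc]

end DescendedField

/-! ### The Hopf map and the diffeomorphism with the 4-sphere. -/

noncomputable section FourSphere

/-- The identification of `ℍ × ℝ` with `ℝ⁵`. -/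
def quaternionProdToEuclidean : ℍ[ℝ] × ℝ →L[ℝ] EuclideanSpace ℝ (Fin 5) :=
  LinearMap.toContinuousLinearMap
    { toFun := fun p => !₂[p.1.re, p.1.imI, p.1.imJ, p.1.imK, p.2]
      map_add' := fun p q => by ext i; fin_cases i <;> simp
      map_smul' := fun r p => by ext i; fin_cases i <;> simp }

/-- The quaternion formed by the first four coordinates of a vector in `ℝ⁵`. -/
def euclideanToQuaternion : EuclideanSpace ℝ (Fin 5) →L[ℝ] ℍ[ℝ] :=
  LinearMap.toContinuousLinearMap
    { toFun := fun y => ⟨y 0, y 1, y 2, y 3⟩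
      map_add' := fun p q => by ext <;> rfl
      map_smul' := fun r p => by ext <;> rfl }

theorem quaternionProdToEuclidean_coords (y : EuclideanSpace ℝ (Fin 5)) :
    quaternionProdToEuclidean (euclideanToQuaternion y, y 4) = y := by
  ext i; fin_cases i <;> rfl

theorem norm_sq_quaternionProdToEuclidean (p : ℍ[ℝ] × ℝ) :
    ‖quaternionProdToEuclidean p‖ ^ 2 = Quaternion.normSq p.1 + p.2 ^ 2 := by
  rw [EuclideanSpace.norm_sq_eq, Fin.sum_univ_five, Quaternion.normSq_def']
  simp only [Real.norm_eq_abs, sq_abs]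
  rfl

theorem normSq_euclideanToQuaternion {y : EuclideanSpace ℝ (Fin 5)}
    (hy : y ∈ Metric.sphere (0 : EuclideanSpace ℝ (Fin 5)) 1) :
    Quaternion.normSq (euclideanToQuaternion y) = 1 - y 4 ^ 2 := by
  have h := norm_sq_quaternionProdToEuclidean (euclideanToQuaternion y, y 4)
  rw [quaternionProdToEuclidean_coords, mem_sphere_zero_iff_norm.1 hy] at h
  simp only at h
  linarith

/-- The Hopf map, in the coordinates `(2 ā₀ a₁, |a₁|² - |a₀|²)` of the first row `(a₀, a₁)`. -/
def hopfCoord (g : Sp2) : ℍ[ℝ] × ℝ :=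
  ((2 : ℝ) • (star (QMat.entry g 0 0) * QMat.entry g 0 1),
    Quaternion.normSq (QMat.entry g 0 1) - Quaternion.normSq (QMat.entry g 0 0))

/-- Both rows are normalised, so the left factor u relating them has norm 1 and cancels in ā₀ ū u
a₁. -/
theorem hopfCoord_eq_of_rel {g h : Sp2} (hr : h * g⁻¹ ∈ spheroid) : hopfCoord g = hopfCoord h := by
  obtain ⟨u, -, hu⟩ := first_row_of_rel hr
  have h1 := first_row_normSq g 0
  have h2 := first_row_normSq h 0
  rw [hu, hu, map_mul, map_mul, ← mul_add, h1, mul_one] at h2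
  have h3 : star u * u = 1 := by rw [Quaternion.star_mul_self, h2]; rfl
  rw [hopfCoord, hopfCoord, hu, hu, map_mul, map_mul, h2, one_mul, one_mul, star_mul, mul_assoc,
    ← mul_assoc (star u), h3, one_mul]

/-- 4|a₀|²|a₁|² + (|a₁|² - |a₀|²)² = (|a₀|² + |a₁|²)² = 1. -/
theorem norm_hopf (g : Sp2) : ‖quaternionProdToEuclidean (hopfCoord g)‖ = 1 := by
  have h1 := first_row_normSq g 0
  rw [zero_add] at h1
  have h2 := norm_sq_quaternionProdToEuclidean (hopfCoord g)
  have h3 : ‖quaternionProdToEuclidean (hopfCoord g)‖ ^ 2 = 1 := by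
    rw [h2, hopfCoord]
    simp only [Quaternion.normSq_smul, map_mul, Quaternion.normSq_star]
    have : Quaternion.normSq (QMat.entry g 0 1) = 1 - Quaternion.normSq (QMat.entry g 0 0) := by
      linarith
    rw [this]; ring
  exact (pow_eq_one_iff_of_nonneg (norm_nonneg _) two_ne_zero).1 h3

theorem contMDiff_hopf : ContMDiff 𝓘(ℝ, sp2) 𝓘(ℝ, EuclideanSpace ℝ (Fin 5)) ∞
    fun g : Sp2 => quaternionProdToEuclidean (hopfCoord g) := by
  have h1 : ContDiff ℝ ∞ fun p : ℍ[ℝ] × ℍ[ℝ] => star p.1 * p.2 :=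
    ContDiff.comp (g := fun p : ℍ[ℝ] × ℍ[ℝ] => p.1 * p.2)
      (f := fun p : ℍ[ℝ] × ℍ[ℝ] => (star p.1, p.2)) contDiff_mul
      ((contDiff_quaternion_star.comp contDiff_fst).prodMk contDiff_snd)
  have h2 : ContDiff ℝ ∞ fun p : ℍ[ℝ] × ℍ[ℝ] =>
      Quaternion.normSq p.2 - Quaternion.normSq p.1 :=
    (contDiff_quaternion_normSq.comp contDiff_snd).sub
      (contDiff_quaternion_normSq.comp contDiff_fst)
  have h3 : ContDiff ℝ ∞ fun p : ℍ[ℝ] × ℍ[ℝ] =>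
      ((2 : ℝ) • (star p.1 * p.2), Quaternion.normSq p.2 - Quaternion.normSq p.1) :=
    (h1.const_smul (2 : ℝ)).prodMk h2
  have h4 : ContMDiff 𝓘(ℝ, sp2) 𝓘(ℝ, ℍ[ℝ] × ℝ) ∞ hopfCoord :=
    ContMDiff.comp (f := fun g : Sp2 => (QMat.entry g 0 0, QMat.entry g 0 1))
      h3.contMDiff ((contMDiff_entry 0 0).prodMk_space (contMDiff_entry 0 1))
  exact quaternionProdToEuclidean.contDiff.contMDiff.comp h4

/-- The map from the coset space to `ℝ⁵` induced by the Hopf map. -/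
def hp1ToEuclidean : HP1 → EuclideanSpace ℝ (Fin 5) :=
  Quotient.lift (fun g => quaternionProdToEuclidean (hopfCoord g)) fun _ _ hr =>
    congrArg _ (hopfCoord_eq_of_rel (QuotientGroup.rightRel_apply.1 hr))

theorem hp1ToEuclidean_projHP1 (g : Sp2) :
    hp1ToEuclidean (projHP1 g) = quaternionProdToEuclidean (hopfCoord g) := rfl

theorem hp1ToEuclidean_mem_sphere (x : HP1) :
    hp1ToEuclidean x ∈ Metric.sphere (0 : EuclideanSpace ℝ (Fin 5)) 1 := by
  obtain ⟨g, rfl⟩ := projHP1_surjective x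
  exact mem_sphere_zero_iff_norm.2 (norm_hopf g)

/-- The affine coordinate a₀⁻¹ a₁ = ā₀ a₁ / |a₀|² is the stereographic projection of the Hopf point
from the north pole. -/
theorem affineCoord_zero_of_hopfCoord {g : Sp2} (h : QMat.entry g 0 0 ≠ 0) :
    affineCoord 0 g = (1 - (hopfCoord g).2)⁻¹ • (hopfCoord g).1 := by
  have h1 := first_row_normSq g 0
  rw [zero_add] at h1
  have h2 : 1 - (hopfCoord g).2 = 2 * Quaternion.normSq (QMat.entry g 0 0) := by
    rw [hopfCoord]; linarith
  have h3 : Quaternion.normSq (QMat.entry g 0 0) ≠ 0 := Quaternion.normSq_ne_zero.2 h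
  rw [h2, affineCoord, hopfCoord, smul_smul, zero_add, Quaternion.inv_def, smul_mul_assoc]
  congr 1
  field_simp

theorem hp1ToEuclidean_injective : Function.Injective hp1ToEuclidean := by
  intro x y hxy
  obtain ⟨g, rfl⟩ := projHP1_surjective x
  obtain ⟨h, rfl⟩ := projHP1_surjective y
  rw [hp1ToEuclidean_projHP1, hp1ToEuclidean_projHP1] at hxy
  have e1 : (hopfCoord g).1 = (hopfCoord h).1 := congrArg euclideanToQuaternion hxy
  have e2 : (hopfCoord g).2 = (hopfCoord h).2 :=
    congrArg (fun y : EuclideanSpace ℝ (Fin 5) => y 4) hxy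
  have hg := first_row_normSq g 0
  have hh := first_row_normSq h 0
  rw [zero_add] at hg hh
  have e3 : Quaternion.normSq (QMat.entry g 0 0) = Quaternion.normSq (QMat.entry h 0 0) := by
    rw [hopfCoord, hopfCoord] at e2
    simp only at e2
    linarith
  -- The lines with a₀ = 0 form a single point, the origin of the other chart; elsewhere the affine
  -- coordinate is recovered from the Hopf point.
  by_cases h0 : QMat.entry g 0 0 = 0
  · have h0' : QMat.entry h 0 0 = 0 := by
      rw [← Quaternion.normSq_eq_zero, ← e3, h0, map_zero]
    have a1 : QMat.entry g 0 1 ≠ 0 := fun h1 => by rw [h0, h1] at hg; simp at hg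
    have b1 : QMat.entry h 0 1 ≠ 0 := fun h1 => by rw [h0', h1] at hh; simp at hh
    have a2 : affineCoord 1 g = 0 := by
      rw [affineCoord, show (1 : Fin 2) + 1 = 0 from rfl, h0, mul_zero]
    have b2 : affineCoord 1 h = 0 := by
      rw [affineCoord, show (1 : Fin 2) + 1 = 0 from rfl, h0', mul_zero]
    rw [← proj_affineSection a1, ← proj_affineSection b1, a2, b2]
  · have h0' : QMat.entry h 0 0 ≠ 0 := by
      rwa [← Quaternion.normSq_ne_zero, ← e3, Quaternion.normSq_ne_zero]
    rw [← proj_affineSection h0, ← proj_affineSection h0', affineCoord_zero_of_hopfCoord h0,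
      affineCoord_zero_of_hopfCoord h0', e1, e2]

theorem inv_sqrt_mul_self (q : ℍ[ℝ]) : (√(1 + Quaternion.normSq q))⁻¹ *
    (√(1 + Quaternion.normSq q))⁻¹ = (1 + Quaternion.normSq q)⁻¹ := by
  rw [← mul_inv, Real.mul_self_sqrt (one_add_normSq_pos q).le]

theorem hopfCoord_affineSection_zero (q : ℍ[ℝ]) : hopfCoord (affineSection 0 q) =
    ((2 * (1 + Quaternion.normSq q)⁻¹) • q,
      (1 + Quaternion.normSq q)⁻¹ * (Quaternion.normSq q - 1)) := by
  have e0 : QMat.entry (affineSection 0 q) 0 0 = (√(1 + Quaternion.normSq q))⁻¹ • 1 := by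
    rw [entry_affineSection]; simp
  have e1 : QMat.entry (affineSection 0 q) 0 1 = (√(1 + Quaternion.normSq q))⁻¹ • q := by
    rw [entry_affineSection]; simp
  rw [hopfCoord, e0, e1, Quaternion.normSq_smul, Quaternion.normSq_smul, pow_two,
    inv_sqrt_mul_self, star_smul, star_trivial, star_one, smul_mul_smul_comm, one_mul,
    inv_sqrt_mul_self, smul_smul, map_one, mul_sub]

/-- The row is now a multiple of (q, 1), so ā₀ a₁ involves q̄; hence the conjugate in
`sphereToHP1One`. -/
theorem hopfCoord_affineSection_one (q : ℍ[ℝ]) : hopfCoord (affineSection 1 q) =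
    ((2 * (1 + Quaternion.normSq q)⁻¹) • star q,
      (1 + Quaternion.normSq q)⁻¹ * (1 - Quaternion.normSq q)) := by
  have e0 : QMat.entry (affineSection 1 q) 0 0 = (√(1 + Quaternion.normSq q))⁻¹ • q := by
    rw [entry_affineSection]; simp
  have e1 : QMat.entry (affineSection 1 q) 0 1 = (√(1 + Quaternion.normSq q))⁻¹ • 1 := by
    rw [entry_affineSection]; simp
  rw [hopfCoord, e0, e1, Quaternion.normSq_smul, Quaternion.normSq_smul, pow_two,
    inv_sqrt_mul_self, star_smul, star_trivial, smul_mul_smul_comm, mul_one,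
    inv_sqrt_mul_self, smul_smul, map_one, mul_sub]

/-- The inverse of the map induced by the Hopf map, away from the north pole. -/
def sphereToHP1Zero (y : EuclideanSpace ℝ (Fin 5)) : HP1 :=
  projHP1 (affineSection 0 ((1 - y 4)⁻¹ • euclideanToQuaternion y))

/-- The inverse of the map induced by the Hopf map, away from the south pole. -/
def sphereToHP1One (y : EuclideanSpace ℝ (Fin 5)) : HP1 :=
  projHP1 (affineSection 1 ((1 + y 4)⁻¹ • star (euclideanToQuaternion y)))

theorem hp1ToEuclidean_sphereToHP1Zero {y : EuclideanSpace ℝ (Fin 5)}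
    (hy : y ∈ Metric.sphere (0 : EuclideanSpace ℝ (Fin 5)) 1) (h : 1 - y 4 ≠ 0) :
    hp1ToEuclidean (sphereToHP1Zero y) = y := by
  have h1 := normSq_euclideanToQuaternion hy
  -- On the sphere the quaternionic part has squared norm 1 - y₄² = (1 - y₄)(1 + y₄), which cancels
  -- against the denominator.
  have h2 : 1 + Quaternion.normSq ((1 - y 4)⁻¹ • euclideanToQuaternion y) = 2 / (1 - y 4) := by
    rw [Quaternion.normSq_smul, h1]; field_simp; ring
  rw [sphereToHP1Zero, hp1ToEuclidean_projHP1, hopfCoord_affineSection_zero]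
  conv_rhs => rw [← quaternionProdToEuclidean_coords y]
  rw [h2, smul_smul]
  congr 2
  · convert! one_smul ℝ (euclideanToQuaternion y) using 2
    field_simp
  · rw [← add_sub_cancel_left 1 (Quaternion.normSq _), h2]
    field_simp; ring

theorem hp1ToEuclidean_sphereToHP1One {y : EuclideanSpace ℝ (Fin 5)}
    (hy : y ∈ Metric.sphere (0 : EuclideanSpace ℝ (Fin 5)) 1) (h : 1 + y 4 ≠ 0) :
    hp1ToEuclidean (sphereToHP1One y) = y := by
  have h1 := normSq_euclideanToQuaternion hy
  have h2 : 1 + Quaternion.normSq ((1 + y 4)⁻¹ • star (euclideanToQuaternion y)) =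
      2 / (1 + y 4) := by
    rw [Quaternion.normSq_smul, Quaternion.normSq_star, h1]; field_simp; ring
  rw [sphereToHP1One, hp1ToEuclidean_projHP1, hopfCoord_affineSection_one]
  conv_rhs => rw [← quaternionProdToEuclidean_coords y]
  rw [h2, star_smul, star_star, star_trivial, smul_smul]
  congr 2
  · convert! one_smul ℝ (euclideanToQuaternion y) using 2
    field_simp
  · rw [← add_sub_cancel_left 1 (Quaternion.normSq _), h2]
    field_simp; ring

open Classical in
/-- The inverse of the map induced by the Hopf map. -/
def sphereToHP1 (y : Metric.sphere (0 : EuclideanSpace ℝ (Fin 5)) 1) : HP1 :=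
  if 1 - (y : EuclideanSpace ℝ (Fin 5)) 4 = 0 then sphereToHP1One y else sphereToHP1Zero y

theorem hp1ToEuclidean_sphereToHP1 (y : Metric.sphere (0 : EuclideanSpace ℝ (Fin 5)) 1) :
    hp1ToEuclidean (sphereToHP1 y) = y := by
  rw [sphereToHP1]
  split_ifs with h
  · exact hp1ToEuclidean_sphereToHP1One y.2 (by intro h'; linarith)
  · exact hp1ToEuclidean_sphereToHP1Zero y.2 h

/-- By injectivity any preimage is the value of the inverse, so the case split in `sphereToHP1` is
immaterial: each stereographic formula agrees with it wherever that formula is valid. -/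
theorem sphereToHP1_eq {y : Metric.sphere (0 : EuclideanSpace ℝ (Fin 5)) 1} {x : HP1}
    (h : hp1ToEuclidean x = y) : sphereToHP1 y = x :=
  hp1ToEuclidean_injective ((hp1ToEuclidean_sphereToHP1 y).trans h.symm)

theorem contMDiff_sphereToHP1 : ContMDiff (𝓡 4) 𝓘(ℝ, ℍ[ℝ]) ∞ sphereToHP1 := by
  intro y
  have hcoe : ContMDiff (𝓡 4) 𝓘(ℝ, EuclideanSpace ℝ (Fin 5)) ∞
      ((↑) : Metric.sphere (0 : EuclideanSpace ℝ (Fin 5)) 1 → EuclideanSpace ℝ (Fin 5)) :=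
    haveI := Fact.mk (finrank_euclideanSpace_fin (𝕜 := ℝ) (n := 4 + 1))
    contMDiff_coe_sphere
  have h4 : ContDiff ℝ ∞ fun z : EuclideanSpace ℝ (Fin 5) => z 4 :=
    (EuclideanSpace.proj (𝕜 := ℝ) (4 : Fin 5)).contDiff
  have hc4 : Continuous fun z : Metric.sphere (0 : EuclideanSpace ℝ (Fin 5)) 1 =>
      (z : EuclideanSpace ℝ (Fin 5)) 4 := h4.continuous.comp continuous_subtype_val
  have hp := fun i => contMDiff_projHP1.comp (contMDiff_affineSection i)
  -- At the north pole the second formula is smooth and valid on a neighbourhood; at every other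
  -- point the first one is.
  by_cases h : 1 - (y : EuclideanSpace ℝ (Fin 5)) 4 = 0
  · have h' : 1 + (y : EuclideanSpace ℝ (Fin 5)) 4 ≠ 0 := by intro h'; linarith
    have h1 : ContDiffAt ℝ ∞ (fun z : EuclideanSpace ℝ (Fin 5) =>
        (1 + z 4)⁻¹ • star (euclideanToQuaternion z)) y :=
      ((contDiff_const.add h4).contDiffAt.inv h').smul
        (contDiff_quaternion_star.comp euclideanToQuaternion.contDiff).contDiffAt
    have h2 := (hp 1 _).comp y (h1.contMDiffAt.comp y (hcoe y))
    refine h2.congr_of_eventuallyEq ?_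
    filter_upwards [(isOpen_ne_fun (continuous_const.add hc4) continuous_const).mem_nhds h']
      with z hz
    exact sphereToHP1_eq (hp1ToEuclidean_sphereToHP1One z.2 hz)
  · have h1 : ContDiffAt ℝ ∞ (fun z : EuclideanSpace ℝ (Fin 5) =>
        (1 - z 4)⁻¹ • euclideanToQuaternion z) y :=
      ((contDiff_const.sub h4).contDiffAt.inv h).smul euclideanToQuaternion.contDiff.contDiffAt
    have h2 := (hp 0 _).comp y (h1.contMDiffAt.comp y (hcoe y))
    refine h2.congr_of_eventuallyEq ?_
    filter_upwards [(isOpen_ne_fun (continuous_const.sub hc4) continuous_const).mem_nhds h]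
      with z hz
    exact sphereToHP1_eq (hp1ToEuclidean_sphereToHP1Zero z.2 hz)

/-- The quaternionic projective line is diffeomorphic to the sphere `S⁴`. -/
def hp1DiffeomorphSphere :
    HP1 ≃ₘ^∞⟮𝓘(ℝ, ℍ[ℝ]), 𝓡 4⟯ Metric.sphere (0 : EuclideanSpace ℝ (Fin 5)) 1 where
  toFun x := ⟨hp1ToEuclidean x, hp1ToEuclidean_mem_sphere x⟩
  invFun := sphereToHP1
  left_inv _ := sphereToHP1_eq rfl
  right_inv y := Subtype.ext (hp1ToEuclidean_sphereToHP1 y)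
  contMDiff_toFun :=
    haveI := Fact.mk (finrank_euclideanSpace_fin (𝕜 := ℝ) (n := 4 + 1))
    ContMDiff.codRestrict_sphere (contMDiff_of_comp_projHP1 contMDiff_hopf)
      hp1ToEuclidean_mem_sphere
  contMDiff_invFun := contMDiff_sphereToHP1

end FourSphere

theorem mainTheorem4 :
    -- `HP1 = Sph \ Sp(2)` is the set of quaternionic lines in `ℍ²`
    (∃ e : HP1 ≃ Projectivization ℍ[ℝ] (Fin 2 → ℍ[ℝ]), ∀ g : Sp2,
      ∃ h : (fun j => QMat.entry g 0 j) ≠ 0,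
        e (projHP1 g) = Projectivization.mk ℍ[ℝ] (fun j => QMat.entry g 0 j) h) ∧
    -- its manifold structure is that of the quotient of `Sp(2)`
    ContMDiff 𝓘(ℝ, sp2) 𝓘(ℝ, ℍ[ℝ]) ∞ projHP1 ∧
    (∀ g : Sp2, Function.Surjective (mfderiv 𝓘(ℝ, sp2) 𝓘(ℝ, ℍ[ℝ]) projHP1 g)) ∧
    -- it is diffeomorphic to `S⁴`
    Nonempty (HP1 ≃ₘ^∞⟮𝓘(ℝ, ℍ[ℝ]), 𝓡 4⟯ Metric.sphere (0 : EuclideanSpace ℝ (Fin 5)) 1) ∧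
    -- `π = Λᴸ - Λᴿ` is a quatrisson structure on `Sp(2)`
    IsQuatrisson bruhatFieldSp2 ∧
    -- it descends to a unique `4`-vector field on `HP1`
    ∃! aleph : MultivectorField 𝓘(ℝ, ℍ[ℝ]) HP1 4,
      (∀ g : Sp2, pushforwardAt 𝓘(ℝ, sp2) 𝓘(ℝ, ℍ[ℝ]) projHP1 g (bruhatFieldSp2 g)
        = aleph (projHP1 g)) ∧
      -- which is a quatrisson structure
      IsQuatrisson aleph ∧
      -- and is invariant under the action of the spheroid
      ∀ s ∈ spheroid, ∀ x : HP1,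
        pushforwardAt 𝓘(ℝ, ℍ[ℝ]) 𝓘(ℝ, ℍ[ℝ]) (rightTranslate s) x (aleph x)
          = aleph (rightTranslate s x) := by
  refine ⟨exists_equiv_projectivization, contMDiff_projHP1, surjective_mfderiv_projHP1,
    ⟨hp1DiffeomorphSphere⟩, isQuatrisson_bruhatFieldSp2, bruhatFieldHP1,
    ⟨relatedBy_projHP1, isQuatrisson_bruhatFieldHP1, fun s hs x => bruhatFieldHP1_invariant hs x⟩,
    fun Q hQ => ?_⟩
  -- Uniqueness needs only the relation with π, since p is surjective.
  funext x
  obtain ⟨g, rfl⟩ := projHP1_surjective x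
  exact (hQ.1 g).symm.trans (relatedBy_projHP1 g)
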